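/- Let $f:\mathbb R^n\to\mathbb R$ be convex, continuous and bounded below, and let $g_1,\dots,g_m:\mathbb R^n\to\mathbb R$ ($m\ge 1$) be continuous, $g_i$ being $\mu_i$-strongly convex with $\mu_i>0$. Put $G=(g_1,\dots,g_m)$, $\underline\mu=\min_i\mu_i$, $\bar\mu=\max_i\mu_i$, $\nabla G(x)=[\nabla g_1(x),\dots,\nabla g_m(x)]$ (with the matrix norm induced by the Euclidean norm), and consider $\min f(x)$ s.t. $g_i(x)\le 0$ for all $i$. Call $(x,y)$ a KKT pair if $y\in\mathbb R^m_+$, $0\in\partial_x\mathcal L(x,y)$ and $\langle y,G(x)\rangle=0$, where $\mathcal L(x,y)=f(x)+\langle y,G(x)\rangle$. Assume: (a) there is $\tilde x$ with $g_i(\tilde x)<0$ for all $i$; (b) every minimizer $x_0^*$ of $f$ over $\mathbb R^n$ has $g_i(x_0^*)>0$ for some $i$; (c) $x^*$ is the optimal solution and $\operatorname{dist}(\partial f(x^*),0)\ge r>0$. Let $\bar c=(f(\tilde x)-\inf f)/\min_i\{-g_i(\tilde x)\}$, $\bar\rho=\bar c\,\bar\mu$, $\mathcal Y=\{y:\|y\|_1\le\bar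 c\}$, let $\mathcal X$ be the closed ball with centre $\tilde x$ and radius $\min_i 2\sqrt{-2\min g_i/\mu_i}$, and let $D_X,D_Y$ be the diameters of $\mathcal X,\mathcal Y$. Assume: (d) the $g_i$ are differentiable at the points of $\mathcal X$, and $\nabla G$ and $G$ are Lipschitz on $\mathcal X$ with constants $L_X>0$ and $L_G>0$. Put $L_{XY}=\bar c L_X$. Algorithm rAPDPro (run without stopping). Input: $\bar\sigma>0$, $\nu_0,\delta\in(0,1)$, a starting point in $\mathcal X\times\mathcal Y$, and $\rho_{\rm init}\ge0$ with $\rho_{\rm init}\le\underline\mu\|y\|_1$ for every $y$ such that $(x^*,y)$ is a KKT pair (for example $\rho_{\rm init}=0$). Let $\bar\tau=(1-\nu_0)(L_{XY}+L_G^2\bar\sigma/\delta)^{-1}$ and $\Delta=D_X^2/\bar\tau+D_Y^2/(2\bar\sigma)$. Epoch $s=0,1,2,\dots$ starts with $(x_0,y_0)$ and $\rho_0$ equal to the last point and the last estimate of the previous epoch (to the starting point and $\rho_{\rm init}$ if $s=0$), $x_{-1}=\bar x_0=x_0$, $\tau_{-1}=\tau_0=\bar\tau$, $\sigma_{-1}=\sigma_0=\bar\sigma$,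 $T_0=0$, $N_s=\infty$. While $k<N_s$, with $k=0,1,2,\dots$, it performs $$\begin{aligned} \mathcal Y_k&=\{y\in\mathbb R^m_+:\underline\mu\|y\|_1\ge\rho_k\}\cap\mathcal Y,\qquad z_k=\bigl(1+\tfrac{\sigma_{k-1}}{\sigma_k}\bigr)G(x_k)-\tfrac{\sigma_{k-1}}{\sigma_k}G(x_{k-1}),\\ y_{k+1}&=\operatorname*{argmin}_{y\in\mathcal Y_k}\|y-(y_k+\sigma_kz_k)\|^2,\\ x_{k+1}&=\operatorname*{argmin}_{x\in\mathcal X}\; f(x)+\langle\nabla G(x_k)y_{k+1},x\rangle+\tfrac1{2\tau_k}\|x-x_k\|^2,\\ t_k&=\sigma_k/\sigma_0,\qquad T_{k+1}=T_k+t_k,\qquad \bar x_{k+1}=(T_k\bar x_k+t_kx_{k+1})/T_{k+1},\\ \rho_{k+1}&=\max\bigl\{\rho_k,\ \underline\mu\, h_1(x_k,\sigma_0\tau_{k-1}\Delta/\sigma_{k-1}),\ \underline\mu\, h_2(\bar x_k,\Delta/T_k)\bigr\},\\ \tau_{k+1}&=\tau_k/\sqrt{1+\rho_{k+1}\tau_k},\qquad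 \sigma_{k+1}=\sigma_k\tau_k/\tau_{k+1},\\ \hat\rho_{k+1}&=\tfrac1{k+1}\sqrt{\hat\rho_k^2k^2+3\rho_{k+1}\hat\rho_kk}\ \ (k\ge1),\qquad \hat\rho_1=3\sqrt{\rho_1/\bar\tau},\\ N_s&=\Bigl\lceil\max\bigl\{6(\hat\rho_{k+1}\bar\tau)^{-1},\ \sqrt2^{\,s}\,3\sqrt2\,D_Y/(\hat\rho_{k+1}D_X\sqrt{\bar\tau\bar\sigma})\bigr\}\Bigr\rceil , \end{aligned}$$ where $h_1(x,\beta)=r\bigl[\|\nabla G(x)\|+L_X\sqrt{2\beta}\bigr]^{-1}$ and $h_2(x,\beta)=\Bigl[\tfrac{L_X}{r}\sqrt{\tfrac{\beta}{2\underline\mu}}+\sqrt{\tfrac{L_X^2\beta}{2\underline\mu r^2}+\tfrac{\|\nabla G(x)\|}{r}}\Bigr]^{-2}$, the term with $h_2$ being absent for $k=0$. Number the index pairs $(s,k)$, including the last $k$ of every epoch, consecutively by $j=0,1,2,\dots$, where $\sigma_{j-1}/\sigma_j$ stands for $\sigma^s_{k-1}/\sigma^s_k$. Theorem. Assume $\bar\tau^{-1}>\bar\rho$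 and $1>\inf_{j\ge0}\{\sigma_{j-1}/\sigma_j\}\ge\delta+\nu_0$. Then for every limit point $y^*$ of the dual sequence $\{y_j\}$ generated by rAPDPro, $(x^*,y^*)$ is a KKT pair. -/

import Mathlib

namespace RAPD

noncomputable section

/-- `ℝᵈ` with the Euclidean norm. -/
abbrev Vec (d : ℕ) : Type := EuclideanSpace ℝ (Fin d)

/-- The `ℓ₁`-norm. -/
def norm1 {d : ℕ} (y : Vec d) : ℝ := ∑ i, |y i|

/-- The subdifferential of a convex function `φ` at `x`. -/
def subdifferential {d : ℕ} (φ : Vec d → ℝ) (x : Vec d) : Set (Vec d) :=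
  {ξ | ∀ z, φ x + inner ℝ ξ (z - x) ≤ φ z}

/-- `u` is a point of `argmin_{v ∈ S} φ(v)`. -/
def IsArgmin {d : ℕ} (S : Set (Vec d)) (φ : Vec d → ℝ) (u : Vec d) : Prop :=
  u ∈ S ∧ ∀ v ∈ S, φ u ≤ φ v

/-- The data of the problem `min f(x)` subject to `g i x ≤ 0` for all `i`: the functions, the
strong convexity moduli `mu i`, a strictly feasible point `xt`, the Lipschitz constants `LX`, `LG`
and the lower bound `r` on the distance from `0` to the subdifferential of `f` at the solution.
(Pure data: everything that is assumed about them is assumed separately.) -/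
structure Problem (n m : ℕ) where
  f : Vec n → ℝ
  g : Fin m → Vec n → ℝ
  mu : Fin m → ℝ
  xt : Vec n
  LX : ℝ
  LG : ℝ
  r : ℝ

namespace Problem

variable {n m : ℕ} (P : Problem n m)

/-- `G(x) = (g₁(x), …, g_m(x))`. -/
def G (x : Vec n) : Vec m := WithLp.toLp 2 (fun i => P.g i x)

/-- `∇G(x) = [∇g₁(x), …, ∇g_m(x)]`, an `n × m` matrix, as the linear map `y ↦ ∑ i, y i • ∇g_i(x)`;
its operator norm is the matrix norm induced by the 2-norm. -/
def gradG (x : Vec n) : Vec m →L[ℝ] Vec n :=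
  ∑ i, (EuclideanSpace.proj i : Vec m →L[ℝ] ℝ).smulRight (gradient (P.g i) x)

/-- The Lagrangian. -/
def lagrangian (x : Vec n) (y : Vec m) : ℝ := P.f x + inner ℝ y (P.G x)

/-- The feasible set. -/
def feasible : Set (Vec n) := {x | ∀ i, P.g i x ≤ 0}

/-- `x` is an optimal solution. -/
def IsOptimal (x : Vec n) : Prop := IsArgmin P.feasible P.f x

/-- The KKT condition for the pair `(x, y)`. -/
def IsKKT (x : Vec n) (y : Vec m) : Prop :=
  (∀ i, 0 ≤ y i) ∧ (0 : Vec n) ∈ subdifferential (fun z => P.lagrangian z y) x ∧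
    inner ℝ y (P.G x) = 0

/-- The smallest strong convexity modulus. -/
def muMin : ℝ := ⨅ i, P.mu i

/-- The largest strong convexity modulus. -/
def muMax : ℝ := ⨆ i, P.mu i

/-- `c̄ = (f(x̃) - min f) / min_i (-g_i(x̃))`. -/
def cbar : ℝ := (P.f P.xt - (⨅ x, P.f x)) / (⨅ i, -P.g i P.xt)

/-- `ρ̄ = c̄ · max_i μ_i`. -/
def rhobar : ℝ := P.cbar * P.muMax

/-- The ball around `x̃` with radius `min_i 2 √(-2 (min g_i) / μ_i)`. -/
def X : Set (Vec n) :=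
  Metric.closedBall P.xt (⨅ i, 2 * √(-2 * (⨅ x, P.g i x) / P.mu i))

/-- The dual ball `{y | ‖y‖₁ ≤ c̄}`. -/
def Y : Set (Vec m) := {y | norm1 y ≤ P.cbar}

/-- Diameter of the primal ball. -/
def DX : ℝ := Metric.diam P.X

/-- Diameter of the dual ball. -/
def DY : ℝ := Metric.diam P.Y

/-- Smoothness constant of the Lagrangian in `x`. -/
def LXY : ℝ := P.cbar * P.LX

/-- Smoothness assumption on the constraints, on the ball `X`. -/
structure LipschitzAssumption : Prop where
  LX_pos : 0 < P.LX
  LG_pos : 0 < P.LG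
  differentiable : ∀ i, ∀ x ∈ P.X, DifferentiableAt ℝ (P.g i) x
  gradG_lipschitz : ∀ x ∈ P.X, ∀ x' ∈ P.X, ‖P.gradG x - P.gradG x'‖ ≤ P.LX * ‖x - x'‖
  G_lipschitz : ∀ x ∈ P.X, ∀ x' ∈ P.X, ‖P.G x - P.G x'‖ ≤ P.LG * ‖x - x'‖

/-- The dual feasible set with the cut: nonnegative `y` in the dual ball, `ρ ≤ ‖y‖₁ · min_i μ_i`. -/
def cutSet (rho : ℝ) : Set (Vec m) :=
  {y | (∀ i, 0 ≤ y i) ∧ rho ≤ norm1 y * P.muMin} ∩ P.Y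

/-- The first lower bound on the `ℓ₁`-norm of a multiplier. -/
def h1 (x : Vec n) (β : ℝ) : ℝ := P.r * (‖P.gradG x‖ + P.LX * √(2 * β))⁻¹

/-- The second lower bound on the `ℓ₁`-norm of a multiplier. -/
def h2 (x : Vec n) (β : ℝ) : ℝ :=
  ((P.LX / P.r * √(β / (2 * P.muMin)) +
    √(P.LX ^ 2 * β / (2 * P.muMin * P.r ^ 2) + ‖P.gradG x‖ / P.r)) ^ 2)⁻¹

/-- The procedure Improve, with `β̄ = Δ / T`. For `T = 0` (no average has been formed yet) `Δ / T` is
`+∞` and the second bound is `0`. -/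
def improve (x xbar : Vec n) (β Δ T rhoOld : ℝ) : ℝ :=
  max rhoOld (P.muMin * max (P.h1 x β) (if T = 0 then 0 else P.h2 xbar (Δ / T)))

end Problem

/-- The input of the algorithm. -/
structure Input (n m : ℕ) where
  /-- initial dual step size of every epoch -/
  sigmabar : ℝ
  nu0 : ℝ
  delta : ℝ
  /-- initial strong convexity estimate -/
  rho0 : ℝ
  x0 : Vec n
  y0 : Vec m

/-- The variables of the algorithm before inner iteration `k` of epoch `s`. -/
structure State (n m : ℕ) where
  /-- epoch -/
  s : ℕ
  /-- inner iteration -/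
  k : ℕ
  /-- current value of the epoch length `N_s` (initially infinite) -/
  N : ℕ∞
  x : Vec n
  /-- previous primal point -/
  xPrev : Vec n
  /-- weighted average of the primal points of the epoch -/
  xBar : Vec n
  y : Vec m
  tau : ℝ
  tauPrev : ℝ
  sigma : ℝ
  sigmaPrev : ℝ
  /-- sum of the weights of the epoch -/
  T : ℝ
  rho : ℝ
  rhoHat : ℝ

section Algorithm

variable {n m : ℕ} (P : Problem n m) (I : Input n m)

/-- `τ̄ = (1 - ν₀) (L_XY + L_G² σ̄ / δ)⁻¹`. -/
def taubar : ℝ := (1 - I.nu0) * (P.LXY + P.LG ^ 2 * I.sigmabar / I.delta)⁻¹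

/-- `Δ_XY = D_X² / τ̄ + D_Y² / (2 σ̄)`. -/
def DeltaXY : ℝ := 1 / taubar P I * P.DX ^ 2 + 1 / (2 * I.sigmabar) * P.DY ^ 2

/-- The state at the start of epoch `s`, from the point `(x, y)` and the estimate `rho`. -/
def epochStart (s : ℕ) (x : Vec n) (y : Vec m) (rho : ℝ) : State n m where
  s := s
  k := 0
  N := ⊤
  x := x
  xPrev := x
  xBar := x
  y := y
  tau := taubar P I
  tauPrev := taubar P I
  sigma := I.sigmabar
  sigmaPrev := I.sigmabar
  T := 0
  rho := rho
  rhoHat := 1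

/-- The new value of `ρ̂` in the procedure TerminateIter. -/
def newRhoHat (rhoHatOld rho : ℝ) (k : ℕ) : ℝ :=
  if k = 0 then 3 * √(rho / taubar P I)
  else 1 / ((k : ℝ) + 1) * √(rhoHatOld ^ 2 * (k : ℝ) ^ 2 + 3 * rho * rhoHatOld * (k : ℝ))

/-- The new value of `N_s` in the procedure TerminateIter. -/
def newN (rhoHat : ℝ) (s : ℕ) : ℕ :=
  ⌈max (6 * (rhoHat * taubar P I)⁻¹)
    ((√2) ^ s * (3 * √2 * P.DY / (rhoHat * P.DX * √(taubar P I * I.sigmabar))))⌉₊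

/-- The weight `t_k = σ_k / σ_0` of the inner iteration. -/
def weight (a : State n m) : ℝ := a.sigma / I.sigmabar

/-- The extrapolated gradient `z_k`. -/
def extrapolation (a : State n m) : Vec m :=
  (1 + a.sigmaPrev / a.sigma) • P.G a.x - (a.sigmaPrev / a.sigma) • P.G a.xPrev

/-- One inner iteration, from the state `a` to the state `b`. -/
structure InnerStep (a b : State n m) : Prop where
  y_step : IsArgmin (P.cutSet a.rho)
    (fun v => ‖v - (a.y + a.sigma • extrapolation P a)‖ ^ 2) b.y
  x_step : IsArgmin P.X
    (fun v => P.f v + inner ℝ (P.gradG a.x b.y) v + 1 / (2 * a.tau) * ‖v - a.x‖ ^ 2) b.x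
  xBar_step : b.xBar = (a.T + weight I a)⁻¹ • (a.T • a.xBar + weight I a • b.x)
  T_step : b.T = a.T + weight I a
  rho_step : b.rho = P.improve a.x a.xBar
    (I.sigmabar * a.tauPrev * DeltaXY P I / a.sigmaPrev) (DeltaXY P I) a.T a.rho
  tau_step : b.tau = a.tau / √(1 + b.rho * a.tau)
  sigma_step : b.sigma = a.sigma * a.tau / b.tau
  rhoHat_step : b.rhoHat = newRhoHat P I a.rhoHat b.rho a.k
  N_step : b.N = (newN P I b.rhoHat a.s : ℕ∞)
  xPrev_step : b.xPrev = a.x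
  tauPrev_step : b.tauPrev = a.tau
  sigmaPrev_step : b.sigmaPrev = a.sigma
  s_step : b.s = a.s
  k_step : b.k = a.k + 1

/-- One step of the algorithm: an inner iteration while `k < N_s`, otherwise a new epoch that is
started from the last point and the last estimate. -/
def Step (a b : State n m) : Prop :=
  ((a.k : ℕ∞) < a.N ∧ InnerStep P I a b) ∨
    (a.N ≤ (a.k : ℕ∞) ∧ b = epochStart P I (a.s + 1) a.x a.y a.rho)

/-- `st` is the sequence of states of the (never stopped) algorithm rAPDPro; it runs through the
index pairs `(s, k)`, `0 ≤ k ≤ N_s`, in lexicographic order. -/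
def IsRun (st : ℕ → State n m) : Prop :=
  st 0 = epochStart P I 0 I.x0 I.y0 I.rho0 ∧ ∀ j, Step P I (st j) (st (j + 1))

end Algorithm

end

end RAPD

/-! For a multiplier `y` of `xs`, `energy` is a Lyapunov function of the saddle point `(xs, y)`:
weighted squared distances, a momentum cross term, and a multiple of the last primal displacement
that absorbs it. An inner iteration lowers it by the weight `t_k` times the Lagrangian gap plus
squared displacements (`energy_step`). This needs two things. Every multiplier must satisfy the cut,
so that it is a competitor in the dual step: the bounds `h1` and `h2` follow from `r ≤ ‖∇G(xs) y‖`
and the energy estimate of the earlier iterations (`rho_le_mul`). And the curvature `ρ_k` that the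
cut guarantees must pay for the growth of the weights.

Multipliers are nonzero, so the gap dominates `‖x - xs‖²`, and each iteration lowers the energy by
at least `κ * residual / t_k` (`exists_energy_decrease`). Since `t_k ≤ 1 + c k`, the sum of `1 /
t_k` diverges, and the residual gets below any threshold within a number of iterations that is the
same for all epochs. By compactness of the dual ball, a small residual forces small energy relative
to some multiplier, perhaps another one (`exists_energy_le_of_residual_le`); monotonicity keeps it
small until the epoch ends (`exists_energy_le_of_le_k`).

A restart multiplies the energy by at most `1 / (1 - δ)`. Either some epoch never ends, or the
factor `√2 ^ s` makes the epochs arbitrarily long; in both cases the energy, relative to a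
multiplier that may vary with `j`, tends to zero. Hence `y_j` approaches the closed set of
multipliers, which contains every limit point. -/

namespace RAPD

open Filter Topology Set

/-! ### Convexity inequalities along segments. -/

section Convexity

variable {E : Type*} [NormedAddCommGroup E] [InnerProductSpace ℝ E]

lemma hasDerivAt_comp_line [CompleteSpace E] {φ : E → ℝ} {x d : E} {s : ℝ}
    (h : DifferentiableAt ℝ φ (x + s • d)) :
    HasDerivAt (fun s : ℝ => φ (x + s • d)) (inner ℝ (gradient φ (x + s • d)) d) s := by
  have h1 := h.hasGradientAt.hasFDerivAt
  have h2 : HasDerivAt (fun s : ℝ => x + s • d) d s := by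
    simpa using ((hasDerivAt_id s).smul_const d).const_add x
  have := h1.comp_hasDerivAt s h2
  simpa [Function.comp_def] using this

/-- Divide the strong convexity inequality on the segment from `x` to `z` by `s` and let `s → 0+`.
-/
lemma _root_.StrongConvexOn.add_inner_gradient_le [CompleteSpace E] {φ : E → ℝ} {μ : ℝ}
    (hφ : StrongConvexOn univ μ φ) {x : E} (hx : DifferentiableAt ℝ φ x) (z : E) :
    φ x + inner ℝ (gradient φ x) (z - x) + μ / 2 * ‖z - x‖ ^ 2 ≤ φ z := by
  have hd : HasDerivAt (fun s : ℝ => φ (x + s • (z - x))) (inner ℝ (gradient φ x) (z - x)) 0 := by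
    have := hasDerivAt_comp_line (φ := φ) (x := x) (d := z - x) (s := 0) (by simpa using hx)
    simpa using this
  have h1 := hd.tendsto_slope_zero_right
  have h2 : Tendsto (fun s : ℝ => φ z - φ x - (1 - s) * (μ / 2 * ‖z - x‖ ^ 2)) (𝓝[>] 0)
      (𝓝 (φ z - φ x - (1 - 0) * (μ / 2 * ‖z - x‖ ^ 2))) := by
    apply Tendsto.mono_left _ nhdsWithin_le_nhds
    apply Continuous.tendsto
    fun_prop
  have h3 := le_of_tendsto_of_tendsto h1 h2 ?_
  · linarith
  · filter_upwards [Ioo_mem_nhdsGT (show (0 : ℝ) < 1 by norm_num)] with s hs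
    have h4 := hφ.2 (mem_univ x) (mem_univ z) (sub_nonneg.2 hs.2.le) hs.1.le (by ring)
    have h5 : (1 - s) • x + s • z = x + s • (z - x) := by module
    rw [h5, norm_sub_rev] at h4
    simp only [smul_eq_mul, zero_add, zero_smul, add_zero] at h4 ⊢
    rw [inv_mul_le_iff₀ hs.1]
    linarith

/-- The descent lemma on a convex set: along the segment, `φ` minus the claimed quadratic has
nonpositive derivative. -/
lemma le_of_gradient_lipschitz [CompleteSpace E] {φ : E → ℝ} {S : Set E} (hS : Convex ℝ S)
    {L : ℝ} (hd : ∀ x ∈ S, DifferentiableAt ℝ φ x)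
    (hL : ∀ x ∈ S, ∀ z ∈ S, ‖gradient φ x - gradient φ z‖ ≤ L * ‖x - z‖)
    {x z : E} (hx : x ∈ S) (hz : z ∈ S) :
    φ z ≤ φ x + inner ℝ (gradient φ x) (z - x) + L / 2 * ‖z - x‖ ^ 2 := by
  set d := z - x with hddef
  have hmem : ∀ s ∈ Icc (0 : ℝ) 1, x + s • d ∈ S := fun s hs =>
    hS.add_smul_sub_mem hx hz hs
  have hder : ∀ s ∈ Icc (0 : ℝ) 1, HasDerivAt
      (fun s : ℝ => φ (x + s • d) - s * inner ℝ (gradient φ x) d - s ^ 2 * (L / 2 * ‖d‖ ^ 2))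
      (inner ℝ (gradient φ (x + s • d)) d - inner ℝ (gradient φ x) d
        - (2 * s) * (L / 2 * ‖d‖ ^ 2)) s := by
    intro s hs
    have h1 := hasDerivAt_comp_line (hd _ (hmem s hs))
    have h2 := (hasDerivAt_id s).mul_const (inner ℝ (gradient φ x) d)
    have h3 := (hasDerivAt_pow 2 s).mul_const (L / 2 * ‖d‖ ^ 2)
    refine ((h1.sub h2).sub h3).congr_deriv ?_
    norm_num
  have hanti : AntitoneOn
      (fun s : ℝ => φ (x + s • d) - s * inner ℝ (gradient φ x) d - s ^ 2 * (L / 2 * ‖d‖ ^ 2))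
      (Icc 0 1) := by
    apply antitoneOn_of_deriv_nonpos (convex_Icc 0 1)
    · exact fun s hs => (hder s hs).continuousAt.continuousWithinAt
    · exact fun s hs =>
        (hder s (interior_subset hs)).differentiableAt.differentiableWithinAt
    · intro s hs
      have hs' := interior_subset hs
      rw [(hder s hs').deriv, ← inner_sub_left]
      have h1 := real_inner_le_norm (gradient φ (x + s • d) - gradient φ x) d
      have h2 := hL _ (hmem s hs') _ hx
      rw [add_sub_cancel_left, norm_smul, Real.norm_of_nonneg hs'.1] at h2
      nlinarith [norm_nonneg d]
  have h := hanti (left_mem_Icc.2 zero_le_one) (right_mem_Icc.2 zero_le_one) zero_le_one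
  simp only [one_smul, zero_smul, add_zero, hddef, add_sub_cancel] at h
  rw [← hddef] at h
  linarith

/-- A proximal step decreases the distance to every competitor. -/
lemma prox_three_point {φ : E → ℝ} {S : Set E} (hφ : ConvexOn ℝ S φ) {c : ℝ} {w u : E}
    (hu : u ∈ S) (hmin : ∀ v ∈ S, φ u + c * ‖u - w‖ ^ 2 ≤ φ v + c * ‖v - w‖ ^ 2)
    {v : E} (hv : v ∈ S) :
    φ u + c * ‖u - w‖ ^ 2 + c * ‖v - u‖ ^ 2 ≤ φ v + c * ‖v - w‖ ^ 2 := by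
  -- As `s → 0` this becomes the variational inequality of `u` in the direction `v - u`; expanding
  -- `‖v - w‖²` around `u` then gives the claim.
  have key : ∀ s ∈ Ioo (0 : ℝ) 1,
      0 ≤ φ v - φ u + 2 * c * inner ℝ (u - w) (v - u) + s * (c * ‖v - u‖ ^ 2) := by
    intro s hs
    have h5 : (1 - s) • u + s • v = u + s • (v - u) := by module
    have h1 := hmin _ (hφ.1 hu hv (sub_nonneg.2 hs.2.le) hs.1.le (by ring))
    have h2 := hφ.2 hu hv (sub_nonneg.2 hs.2.le) hs.1.le (by ring)
    rw [h5] at h1 h2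
    have h6 : u + s • (v - u) - w = (u - w) + s • (v - u) := by module
    rw [h6, norm_add_sq_real, inner_smul_right, norm_smul, Real.norm_of_nonneg hs.1.le] at h1
    simp only [smul_eq_mul] at h2
    have h7 : 0 ≤ s * (φ v - φ u + 2 * c * inner ℝ (u - w) (v - u)
        + s * (c * ‖v - u‖ ^ 2)) := by nlinarith
    exact nonneg_of_mul_nonneg_right h7 hs.1
  have h2 : Tendsto (fun s : ℝ => φ v - φ u + 2 * c * inner ℝ (u - w) (v - u)
      + s * (c * ‖v - u‖ ^ 2)) (𝓝[>] 0)
      (𝓝 (φ v - φ u + 2 * c * inner ℝ (u - w) (v - u) + 0 * (c * ‖v - u‖ ^ 2))) := by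
    apply Tendsto.mono_left _ nhdsWithin_le_nhds
    apply Continuous.tendsto
    fun_prop
  have h3 := ge_of_tendsto h2 (by
    filter_upwards [Ioo_mem_nhdsGT (show (0 : ℝ) < 1 by norm_num)] with s hs using key s hs)
  have h6 : v - w = (u - w) + (v - u) := by module
  rw [h6, norm_add_sq_real]
  linarith

/-- Ensures that the infima in the radius of `X` are true infima and not the default value of an
unbounded `⨅`. A lower bound on the unit ball propagates along rays from the origin, where the
quadratic term beats the linear one. -/
lemma _root_.StrongConvexOn.bddBelow [ProperSpace E] {φ : E → ℝ} {μ : ℝ} (hμ : 0 < μ)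
    (hφ : StrongConvexOn univ μ φ) (hc : Continuous φ) : BddBelow (range φ) := by
  obtain ⟨B, hB⟩ := (isCompact_closedBall (0 : E) 1).bddBelow_image hc.continuousOn
  have hB' : ∀ z, ‖z‖ ≤ 1 → B ≤ φ z := fun z hz =>
    hB ⟨z, by simpa using hz, rfl⟩
  have h0 : B ≤ φ 0 := hB' 0 (by simp)
  set C := φ 0 - B with hC
  -- With `e = ‖x‖ - 1 > 0`, the ray estimate gives `φ x ≥ φ 0 - C - C e + μ e² / 2`, and `C ^ 2 /
  -- (2 * μ)` is the cost of completing the square.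
  refine ⟨φ 0 - C ^ 2 / (2 * μ) - C - μ / 2, ?_⟩
  rintro _ ⟨x, rfl⟩
  by_cases hx : ‖x‖ ≤ 1
  · have h1 := hB' x hx
    have : 0 ≤ C ^ 2 / (2 * μ) := by positivity
    linarith
  · push Not at hx
    set d := ‖x‖ with hd
    have hd0 : 0 < d := by linarith
    have h1 := hφ.2 (mem_univ 0) (mem_univ x) (sub_nonneg.2 (inv_le_one_of_one_le₀ hx.le))
      (inv_nonneg.2 hd0.le) (by ring)
    have h2 := hB' ((1 - d⁻¹) • 0 + d⁻¹ • x) (by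
      simp [norm_smul, abs_of_pos hd0, ← hd, hd0.ne'])
    simp only [smul_eq_mul, zero_sub, norm_neg, ← hd] at h1
    have h3 : B ≤ (1 - d⁻¹) * φ 0 + d⁻¹ * φ x - (1 - d⁻¹) * d⁻¹ * (μ / 2 * d ^ 2) := h2.trans h1
    have h4 : d * B ≤ (d - 1) * φ 0 + φ x - (d - 1) * (μ / 2 * d) := by
      have := mul_le_mul_of_nonneg_left h3 hd0.le
      have e : d * ((1 - d⁻¹) * φ 0 + d⁻¹ * φ x - (1 - d⁻¹) * d⁻¹ * (μ / 2 * d ^ 2)) =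
        (d - 1) * φ 0 + φ x - (d - 1) * (μ / 2 * d) := by
        field_simp
      linarith
    have h5 : C ^ 2 / (2 * μ) - C * (d - 1) + (d - 1) ^ 2 * (μ / 2) =
        (C - μ * (d - 1)) ^ 2 / (2 * μ) := by
      field_simp
      ring
    have h6 : 0 ≤ (C - μ * (d - 1)) ^ 2 / (2 * μ) := by positivity
    nlinarith

/-- Points of a sublevel set of a strongly convex function are close to each other. -/
lemma _root_.StrongConvexOn.mul_norm_sub_sq_le {φ : E → ℝ} {μ : ℝ}
    (hφ : StrongConvexOn univ μ φ) (hb : BddBelow (range φ)) (x z : E) :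
    μ / 8 * ‖x - z‖ ^ 2 ≤ (φ x + φ z) / 2 - ⨅ v, φ v := by
  have h1 := hφ.2 (mem_univ x) (mem_univ z) (show (0 : ℝ) ≤ 1 / 2 by norm_num)
    (show (0 : ℝ) ≤ 1 / 2 by norm_num) (by norm_num)
  have h2 := ciInf_le hb ((1 / 2 : ℝ) • x + (1 / 2 : ℝ) • z)
  simp only [smul_eq_mul] at h1
  linarith

end Convexity

/-! ### Lagrange multipliers by separation. -/

section Slater

variable {E : Type*} [AddCommGroup E] [Module ℝ E] {m : ℕ}

/-- Lagrange multipliers of a convex program that satisfies Slater's condition. -/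
theorem exists_multiplier {f : E → ℝ} {g : Fin m → E → ℝ} (hf : ConvexOn ℝ univ f)
    (hg : ∀ i, ConvexOn ℝ univ (g i)) {p : ℝ} (hp : ∀ x, (∀ i, g i x ≤ 0) → p ≤ f x)
    {xt : E} (hxt : ∀ i, g i xt < 0) :
    ∃ y : Fin m → ℝ, (∀ i, 0 ≤ y i) ∧ ∀ x, p ≤ f x + ∑ i, y i * g i x := by
  -- The strictly dominated values form an open convex set that misses `(0, p)`; the normal of a
  -- separating hyperplane, normalised in the objective coordinate, is the multiplier. Strict
  -- inequalities make `A` open without any topology on `E`.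
  set A : Set ((Fin m → ℝ) × ℝ) := {a | ∃ x, (∀ i, g i x < a.1 i) ∧ f x < a.2} with hA
  have hopen : IsOpen A := by
    have : A = ⋃ x, (univ.pi fun i => Ioi (g i x)) ×ˢ Ioi (f x) := by
      ext a; simp [hA, mem_prod, Set.mem_pi]
    rw [this]
    exact isOpen_iUnion fun x => (isOpen_set_pi finite_univ fun i _ => isOpen_Ioi).prod isOpen_Ioi
  have hconv : Convex ℝ A := by
    rintro a ⟨x, hx1, hx2⟩ b ⟨z, hz1, hz2⟩ s t hs ht hst
    have aux : ∀ u v u' v' : ℝ, u < u' → v < v' → s * u + t * v < s * u' + t * v' := by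
      intro u v u' v' h1 h2
      rcases hs.lt_or_eq with h | h
      · nlinarith
      · have : t = 1 := by linarith
        subst this; rw [← h]; linarith
    refine ⟨s • x + t • z, fun i => ?_, ?_⟩
    · exact lt_of_le_of_lt ((hg i).2 (mem_univ x) (mem_univ z) hs ht hst)
        (aux _ _ _ _ (hx1 i) (hz1 i))
    · exact lt_of_le_of_lt (hf.2 (mem_univ x) (mem_univ z) hs ht hst) (aux _ _ _ _ hx2 hz2)
  have hnot : ((0 : Fin m → ℝ), p) ∉ A := by
    rintro ⟨x, hx1, hx2⟩
    exact absurd (hp x fun i => (hx1 i).le) (not_le.2 hx2)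
  obtain ⟨φ, hφ⟩ := geometric_hahn_banach_open_point hconv hopen hnot
  set l : Fin m → ℝ := fun i => φ (Pi.single i 1, 0) with hl
  set l0 : ℝ := φ (0, 1) with hl0
  have hφeq : ∀ (u : Fin m → ℝ) (t : ℝ), φ (u, t) = ∑ i, u i * l i + t * l0 := by
    intro u t
    have : (u, t) = ∑ i, u i • ((Pi.single i 1 : Fin m → ℝ), (0 : ℝ)) + t • ((0 : Fin m → ℝ), (1 : ℝ)) := by
      ext j
      · simp [Prod.fst_sum, Finset.sum_apply, Pi.single_apply]
      · simp [Prod.snd_sum]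
    rw [this, map_add, map_sum]
    simp only [map_smul, smul_eq_mul, hl, hl0]
  have key : ∀ x (e : Fin m → ℝ) (e0 : ℝ), (∀ i, 0 < e i) → 0 < e0 →
      ∑ i, (g i x + e i) * l i + (f x + e0) * l0 < p * l0 := by
    intro x e e0 he he0
    have := hφ (fun i => g i x + e i, f x + e0)
      ⟨x, fun i => by simpa using he i, by simpa using he0⟩
    rw [hφeq, hφeq] at this
    simpa using this
  have keyle : ∀ x (e : Fin m → ℝ) (e0 : ℝ), (∀ i, 0 ≤ e i) → 0 ≤ e0 →
      ∑ i, (g i x + e i) * l i + (f x + e0) * l0 ≤ p * l0 := by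
    intro x e e0 he he0
    have ht : Tendsto (fun s : ℝ => ∑ i, (g i x + (e i + s)) * l i + (f x + (e0 + s)) * l0)
        (𝓝[>] 0) (𝓝 (∑ i, (g i x + (e i + 0)) * l i + (f x + (e0 + 0)) * l0)) := by
      apply Tendsto.mono_left _ nhdsWithin_le_nhds
      apply Continuous.tendsto
      fun_prop
    have := le_of_tendsto ht (b := p * l0) (by
      filter_upwards [self_mem_nhdsWithin] with s hs
      exact (key x (fun i => e i + s) (e0 + s) (fun i => add_pos_of_nonneg_of_pos (he i) hs)
        (add_pos_of_nonneg_of_pos he0 hs)).le)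
    simpa using this
  have nonpos_of : ∀ a b : ℝ, (∀ s : ℝ, 0 ≤ s → b + s * a ≤ 0) → a ≤ 0 := by
    intro a b h
    by_contra! ha
    have := h ((|b| + 1) / a) (by positivity)
    rw [div_mul_cancel₀ _ ha.ne'] at this
    linarith [neg_abs_le b]
  have hl_nonpos : ∀ i, l i ≤ 0 := by
    intro i
    apply nonpos_of _ (∑ i, g i xt * l i + f xt * l0 - p * l0)
    intro s hs
    have := keyle xt (Pi.single i s) 0 (fun j => by
      by_cases h : j = i
      · subst h; simpa using hs
      · simp [h]) le_rfl
    simp only [add_mul, Finset.sum_add_distrib, Pi.single_apply, ite_mul, zero_mul,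
      Finset.sum_ite_eq', Finset.mem_univ, if_true] at this
    linarith
  have hl0_nonpos : l0 ≤ 0 := by
    apply nonpos_of _ (∑ i, g i xt * l i + f xt * l0 - p * l0)
    intro s hs
    have := keyle xt 0 s (fun j => le_rfl) hs
    simp only [Pi.zero_apply, add_zero] at this
    linarith
  -- Slater's point excludes a hyperplane with no objective component: half of its slack can be
  -- given away while all constraint values stay negative.
  have hl0_neg : l0 < 0 := by
    refine lt_of_le_of_ne hl0_nonpos fun h0 => ?_
    have := key xt (fun i => -g i xt / 2) 1 (fun i => by linarith [hxt i]) one_pos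
    rw [h0] at this
    have h2 : 0 ≤ ∑ i, (g i xt + -g i xt / 2) * l i :=
      Finset.sum_nonneg fun i _ => mul_nonneg_of_nonpos_of_nonpos (by linarith [hxt i])
        (hl_nonpos i)
    linarith
  refine ⟨fun i => l i / l0, fun i => div_nonneg_of_nonpos (hl_nonpos i) hl0_nonpos, fun x => ?_⟩
  have := keyle x 0 0 (fun _ => le_rfl) le_rfl
  simp only [Pi.zero_apply, add_zero] at this
  have e : ∑ i, l i / l0 * g i x = (∑ i, g i x * l i) / l0 := by
    rw [Finset.sum_div]; exact Finset.sum_congr rfl fun i _ => by ring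
  rw [e]
  have h3 : (∑ i, g i x * l i) / l0 * l0 = ∑ i, g i x * l i := div_mul_cancel₀ _ hl0_neg.ne
  by_contra! hcon
  nlinarith

end Slater

end RAPD

namespace RAPD

open Filter Topology Set

section Norm1

variable {m : ℕ}

lemma norm1_nonneg (y : Vec m) : 0 ≤ norm1 y := Finset.sum_nonneg fun _ _ => abs_nonneg _

lemma norm1_of_nonneg {y : Vec m} (hy : ∀ i, 0 ≤ y i) : norm1 y = ∑ i, y i :=
  Finset.sum_congr rfl fun i _ => abs_of_nonneg (hy i)

lemma norm_le_norm1 (y : Vec m) : ‖y‖ ≤ norm1 y := by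
  rw [EuclideanSpace.norm_eq]
  apply Real.sqrt_le_iff.2 ⟨norm1_nonneg y, ?_⟩
  simpa [norm1] using Finset.sum_sq_le_sq_sum_of_nonneg (s := Finset.univ) (f := fun i => |y i|)
    fun i _ => abs_nonneg _

lemma continuous_norm1 : Continuous (norm1 : Vec m → ℝ) := by
  unfold norm1
  fun_prop

end Norm1

/-! ### KKT multipliers: existence, bounds and growth of the Lagrangian. -/

namespace Problem

variable {n m : ℕ} {P : Problem n m}

lemma inner_G (x : Vec n) (y : Vec m) : inner ℝ y (P.G x) = ∑ i, y i * P.g i x := by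
  simp [PiLp.inner_apply, G, mul_comm]

lemma gradG_apply (x : Vec n) (y : Vec m) : P.gradG x y = ∑ i, y i • gradient (P.g i) x := by
  simp [gradG]

lemma inner_gradG (x d : Vec n) (y : Vec m) :
    inner ℝ (P.gradG x y) d = ∑ i, y i * inner ℝ (gradient (P.g i) x) d := by
  simp [gradG_apply, sum_inner, real_inner_smul_left]

lemma muMin_le (P : Problem n m) (i : Fin m) : P.muMin ≤ P.mu i := ciInf_le (finite_range _).bddBelow i

lemma convex_X (P : Problem n m) : Convex ℝ P.X := convex_closedBall _ _

lemma isBounded_X (P : Problem n m) : Bornology.IsBounded P.X := Metric.isBounded_closedBall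

lemma isBounded_Y (P : Problem n m) : Bornology.IsBounded P.Y :=
  (Metric.isBounded_closedBall (x := (0 : Vec m)) (r := P.cbar)).subset fun y hy => by
    simpa using (norm_le_norm1 y).trans hy

lemma isCompact_Y (P : Problem n m) : IsCompact P.Y :=
  Metric.isCompact_of_isClosed_isBounded (isClosed_le continuous_norm1 continuous_const)
    P.isBounded_Y

lemma norm_sub_le_DX {x z : Vec n} (hx : x ∈ P.X) (hz : z ∈ P.X) : ‖x - z‖ ≤ P.DX := by
  rw [← dist_eq_norm]; exact Metric.dist_le_diam_of_mem P.isBounded_X hx hz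

lemma norm_sub_le_DY {x z : Vec m} (hx : x ∈ P.Y) (hz : z ∈ P.Y) : ‖x - z‖ ≤ P.DY := by
  rw [← dist_eq_norm]; exact Metric.dist_le_diam_of_mem P.isBounded_Y hx hz

lemma lagrangian_kkt {xs : Vec n} {y : Vec m} (hy : P.IsKKT xs y) : P.lagrangian xs y = P.f xs := by
  rw [lagrangian, hy.2.2, add_zero]

/-- A lower bound on a norm is not convex in general, but on the nonnegative orthant the `ℓ₁`-norm
is linear. -/
lemma convex_cutSet (ρ : ℝ) : Convex ℝ (P.cutSet ρ) := by
  rintro u ⟨⟨hu0, hu1⟩, hu2⟩ v ⟨⟨hv0, hv1⟩, hv2⟩ a b ha hb hab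
  have hnn : ∀ i, 0 ≤ (a • u + b • v) i := fun i => by
    simpa using add_nonneg (mul_nonneg ha (hu0 i)) (mul_nonneg hb (hv0 i))
  have e : norm1 (a • u + b • v) = a * norm1 u + b * norm1 v := by
    rw [norm1_of_nonneg hnn, norm1_of_nonneg hu0, norm1_of_nonneg hv0, Finset.mul_sum,
      Finset.mul_sum, ← Finset.sum_add_distrib]
    simp
  simp only [Y, mem_ofPred_eq] at hu2 hv2
  have hb' : b = 1 - a := by linarith
  refine ⟨⟨hnn, ?_⟩, ?_⟩
  · rw [e, hb']; rw [hb'] at hb; nlinarith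
  · change norm1 _ ≤ P.cbar
    rw [e, hb']; rw [hb'] at hb; nlinarith

lemma le_lagrangian {xs : Vec n} {y : Vec m} (hy : P.IsKKT xs y) (z : Vec n) :
    P.f xs ≤ P.lagrangian z y := by
  have := hy.2.1 z
  simpa [lagrangian_kkt hy] using this

lemma isClosed_kkt (xs : Vec n) : IsClosed {y | P.IsKKT xs y} := by
  have h1 : IsClosed {y : Vec m | ∀ i, 0 ≤ y i} := by
    simp only [ofPred_forall]
    exact isClosed_iInter fun i => isClosed_le continuous_const (by fun_prop)
  have h2 : IsClosed {y : Vec m | ∀ z, P.lagrangian xs y + inner ℝ (0 : Vec n) (z - xs)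
      ≤ P.lagrangian z y} := by
    simp only [ofPred_forall]
    refine isClosed_iInter fun i => isClosed_le ?_ ?_ <;> unfold lagrangian <;> fun_prop
  have h3 : IsClosed {y : Vec m | inner ℝ y (P.G xs) = 0} :=
    isClosed_eq (by fun_prop) continuous_const
  exact h1.inter (h2.inter h3)

/-- The standing assumptions on the problem and its solution. -/
structure Regular (P : Problem n m) (xs : Vec n) : Prop where
  m_pos : 0 < m
  f_conv : ConvexOn ℝ univ P.f
  f_cont : Continuous P.f
  f_bdd : BddBelow (range P.f)
  mu_pos : ∀ i, 0 < P.mu i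
  g_conv : ∀ i, StrongConvexOn univ (P.mu i) (P.g i)
  g_cont : ∀ i, Continuous (P.g i)
  slater : ∀ i, P.g i P.xt < 0
  not_feasible : ∀ x₀, (∀ x, P.f x₀ ≤ P.f x) → ∃ i, 0 < P.g i x₀
  opt : P.IsOptimal xs
  r_pos : 0 < P.r
  r_le : P.r ≤ Metric.infDist 0 (subdifferential P.f xs)
  lip : P.LipschitzAssumption

namespace Regular

variable {xs : Vec n} (H : P.Regular xs)

include H

lemma muMin_pos : 0 < P.muMin := by
  have : Nonempty (Fin m) := ⟨⟨0, H.m_pos⟩⟩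
  obtain ⟨i, hi⟩ := exists_eq_ciInf_of_finite (f := P.mu)
  rw [muMin, ← hi]
  exact H.mu_pos i

lemma continuous_G : Continuous P.G := by
  have := H.g_cont
  unfold G
  fun_prop

lemma feasible_xs (i : Fin m) : P.g i xs ≤ 0 := H.opt.1 i

lemma exists_lt : ∃ x, P.f x < P.f xs := by
  by_contra! h
  obtain ⟨i, hi⟩ := H.not_feasible xs h
  exact absurd (H.feasible_xs i) (not_le.2 hi)

lemma slack_pos : 0 < ⨅ i, -P.g i P.xt := by
  have : Nonempty (Fin m) := ⟨⟨0, H.m_pos⟩⟩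
  obtain ⟨i, hi⟩ := exists_eq_ciInf_of_finite (f := fun i => -P.g i P.xt)
  rw [← hi]
  exact neg_pos.2 (H.slater i)

lemma cbar_pos : 0 < P.cbar := by
  refine div_pos ?_ H.slack_pos
  obtain ⟨x, hx⟩ := H.exists_lt
  have h1 : P.f xs ≤ P.f P.xt := H.opt.2 _ fun i => (H.slater i).le
  have h2 : ⨅ x, P.f x ≤ P.f x := ciInf_le H.f_bdd x
  linarith

/-- Both points lie in the zero sublevel set of each `g i`, whose size strong convexity controls.
The inequality is strict because `g i P.xt < 0`; thus `xs` is interior to `X`, and minimality over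
`X` near `xs` becomes global by convexity. -/
lemma xs_mem_ball : dist xs P.xt < ⨅ i, 2 * √(-2 * (⨅ x, P.g i x) / P.mu i) := by
  have : Nonempty (Fin m) := ⟨⟨0, H.m_pos⟩⟩
  obtain ⟨i, hi⟩ := exists_eq_ciInf_of_finite
    (f := fun i => 2 * √(-2 * (⨅ x, P.g i x) / P.mu i))
  rw [← hi, dist_eq_norm]
  have hmu := H.mu_pos i
  have hb := (H.g_conv i).bddBelow hmu (H.g_cont i)
  have h1 := (H.g_conv i).mul_norm_sub_sq_le hb xs P.xt
  have h2 := H.feasible_xs i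
  have h3 := H.slater i
  have h4 : (‖xs - P.xt‖ / 2) ^ 2 < -2 * (⨅ x, P.g i x) / P.mu i := by
    rw [lt_div_iff₀ hmu]
    nlinarith
  have h5 := Real.lt_sqrt_of_sq_lt h4
  linarith

lemma X_mem_nhds : P.X ∈ 𝓝 xs := by
  refine mem_of_superset (Metric.isOpen_ball.mem_nhds ?_) Metric.ball_subset_closedBall
  exact H.xs_mem_ball

lemma xs_mem : xs ∈ P.X := mem_of_mem_nhds H.X_mem_nhds

lemma DX_pos : 0 < P.DX := by
  obtain ⟨x, hx⟩ := H.exists_lt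
  -- This excludes dimension zero, where the ball would be a single point.
  have : Nontrivial (Vec n) := ⟨x, xs, fun h => by simp [h] at hx⟩
  refine Metric.diam_pos ?_ P.isBounded_X
  by_contra h
  rw [not_nontrivial_iff] at h
  have h1 : P.X = {xs} := h.eq_singleton_of_mem H.xs_mem
  have h2 := H.X_mem_nhds
  have h3 : (𝓝[≠] xs).NeBot := Module.punctured_nhds_neBot ℝ _ xs
  rw [h1] at h2
  refine not_isOpen_singleton xs (isOpen_iff_mem_nhds.2 fun x hx => ?_)
  rwa [mem_singleton_iff.1 hx]

lemma DY_pos : 0 < P.DY := by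
  refine Metric.diam_pos ⟨0, ?_, EuclideanSpace.single ⟨0, H.m_pos⟩ P.cbar, ?_, ?_⟩ P.isBounded_Y
  · simpa [Y, norm1] using H.cbar_pos.le
  · have := H.cbar_pos
    simp [Y, norm1, apply_ite abs, abs_of_pos this]
  · intro h
    have := congrArg norm h
    simp only [norm_zero, PiLp.norm_single, Real.norm_eq_abs] at this
    exact H.cbar_pos.ne' (abs_eq_zero.1 this.symm)

lemma inner_G_xs_nonpos {y : Vec m} (hy : ∀ i, 0 ≤ y i) : inner ℝ y (P.G xs) ≤ 0 := by
  rw [inner_G]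
  exact Finset.sum_nonpos fun i _ => mul_nonpos_of_nonneg_of_nonpos (hy i) (H.feasible_xs i)

lemma strong_gradient_le {x : Vec n} (hx : x ∈ P.X) {y : Vec m} (hy : ∀ i, 0 ≤ y i)
    (z : Vec n) :
    inner ℝ y (P.G x) + inner ℝ (P.gradG x y) (z - x) + norm1 y * P.muMin / 2 * ‖z - x‖ ^ 2
      ≤ inner ℝ y (P.G z) := by
  rw [inner_G, inner_G, inner_gradG, norm1_of_nonneg hy]
  have : (∑ i, y i) * P.muMin / 2 * ‖z - x‖ ^ 2
      = ∑ i, y i * (P.muMin / 2 * ‖z - x‖ ^ 2) := by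
    rw [← Finset.sum_mul]; ring
  rw [this, ← Finset.sum_add_distrib, ← Finset.sum_add_distrib]
  refine Finset.sum_le_sum fun i _ => ?_
  rw [← mul_add, ← mul_add]
  refine mul_le_mul_of_nonneg_left ?_ (hy i)
  have h1 := (H.g_conv i).add_inner_gradient_le (H.lip.differentiable i x hx) z
  have h2 : P.muMin / 2 * ‖z - x‖ ^ 2 ≤ P.mu i / 2 * ‖z - x‖ ^ 2 := by
    have := P.muMin_le i
    gcongr
  linarith

lemma hasGradientAt_inner_G {x : Vec n} (hx : x ∈ P.X) (y : Vec m) :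
    HasGradientAt (fun z => inner ℝ y (P.G z)) (P.gradG x y) x := by
  simp only [inner_G]
  rw [hasGradientAt_iff_hasFDerivAt]
  have h := HasFDerivAt.fun_sum (u := Finset.univ) fun i _ =>
    ((H.lip.differentiable i x hx).hasGradientAt.hasFDerivAt).const_mul (y i)
  refine h.congr_fderiv ?_
  ext d
  simp [gradG_apply]

lemma le_gradient {x z : Vec n} (hx : x ∈ P.X) (hz : z ∈ P.X) {y : Vec m}
    (hy : norm1 y ≤ P.cbar) :
    inner ℝ y (P.G z) ≤ inner ℝ y (P.G x) + inner ℝ (P.gradG x y) (z - x)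
      + P.LXY / 2 * ‖z - x‖ ^ 2 := by
  have hg := fun x hx => (H.hasGradientAt_inner_G (x := x) hx y).gradient
  have h := le_of_gradient_lipschitz (φ := fun z => inner ℝ y (P.G z)) P.convex_X (L := P.LXY)
    (fun x hx => (H.hasGradientAt_inner_G hx y).differentiableAt) ?_ hx hz
  · rwa [hg x hx] at h
  · intro u hu v hv
    rw [hg u hu, hg v hv, ← sub_apply]
    refine (ContinuousLinearMap.le_opNorm _ _).trans ?_
    have h1 := H.lip.gradG_lipschitz u hu v hv
    have h2 := (norm_le_norm1 y).trans hy
    have h3 := H.lip.LX_pos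
    calc ‖P.gradG u - P.gradG v‖ * ‖y‖ ≤ (P.LX * ‖u - v‖) * P.cbar := by gcongr
      _ = P.LXY * ‖u - v‖ := by rw [LXY]; ring

theorem exists_kkt : ∃ y, P.IsKKT xs y := by
  obtain ⟨y, hy0, hy⟩ := exists_multiplier H.f_conv
    (fun i => (H.g_conv i).convexOn fun r => by have := H.mu_pos i; positivity)
    (p := P.f xs) (fun x hx => H.opt.2 x hx) H.slater
  have hin : ∀ x, P.lagrangian x (WithLp.toLp 2 y) = P.f x + ∑ i, y i * P.g i x := by
    intro x; rw [lagrangian, inner_G]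
  have hle := H.inner_G_xs_nonpos (y := WithLp.toLp 2 y) hy0
  have h0 : inner ℝ (WithLp.toLp 2 y) (P.G xs) = 0 := by
    have := hy xs
    rw [← hin, lagrangian] at this
    linarith
  refine ⟨WithLp.toLp 2 y, hy0, fun z => ?_, h0⟩
  have h1 := hy z
  rw [← hin] at h1
  simpa [lagrangian, h0] using h1

/-- Compare the Lagrangian at `xs` and at the Slater point, where each unit of `norm1 y` lowers it
by at least the smallest slack. -/
lemma kkt_mem_Y {y : Vec m} (hy : P.IsKKT xs y) : y ∈ P.Y := by
  change norm1 y ≤ P.cbar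
  rw [cbar, le_div_iff₀ H.slack_pos, norm1_of_nonneg hy.1, Finset.sum_mul]
  have h1 := le_lagrangian hy P.xt
  rw [lagrangian, inner_G] at h1
  obtain ⟨x, hx⟩ := H.exists_lt
  have h2 : ⨅ x, P.f x ≤ P.f x := ciInf_le H.f_bdd x
  have h3 : ∑ i, y i * (⨅ i, -P.g i P.xt) ≤ ∑ i, y i * (-P.g i P.xt) :=
    Finset.sum_le_sum fun i _ => mul_le_mul_of_nonneg_left
      (ciInf_le (finite_range fun i => -P.g i P.xt).bddBelow i) (hy.1 i)
  have h4 : ∑ i, y i * (-P.g i P.xt) = - ∑ i, y i * P.g i P.xt := by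
    rw [← Finset.sum_neg_distrib]; exact Finset.sum_congr rfl fun i _ => by ring
  linarith

lemma neg_gradG_mem_subdifferential {y : Vec m} (hy : P.IsKKT xs y) :
    -P.gradG xs y ∈ subdifferential P.f xs := by
  intro z
  have hdiff := H.hasGradientAt_inner_G H.xs_mem y
  have hd := hasDerivAt_comp_line (φ := fun z => inner ℝ y (P.G z)) (x := xs) (d := z - xs)
    (s := 0) (by simpa using hdiff.differentiableAt)
  simp only [zero_smul, add_zero] at hd
  rw [hdiff.gradient] at hd
  have h3 := ge_of_tendsto hd.tendsto_slope_zero_right (b := P.f xs - P.f z) ?_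
  · rw [inner_neg_left]; linarith
  · filter_upwards [Ioo_mem_nhdsGT (show (0 : ℝ) < 1 by norm_num)] with s hs
    have h4 := H.f_conv.2 (mem_univ xs) (mem_univ z) (sub_nonneg.2 hs.2.le) hs.1.le (by ring)
    have h5 : (1 - s) • xs + s • z = xs + s • (z - xs) := by module
    rw [h5] at h4
    simp only [smul_eq_mul, zero_add, zero_smul, add_zero] at h4 ⊢
    have h6 := le_lagrangian hy (xs + s • (z - xs))
    rw [lagrangian] at h6
    rw [le_inv_mul_iff₀ hs.1, hy.2.2]
    linarith

lemma r_le_norm {y : Vec m} (hy : P.IsKKT xs y) : P.r ≤ ‖P.gradG xs y‖ := by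
  have := H.r_le.trans (Metric.infDist_le_dist_of_mem (H.neg_gradG_mem_subdifferential hy))
  simpa using this

/-- The curvature comes from the constraints alone, in proportion to `norm1 y`; the first-order
terms of `f` and `G` cancel by stationarity. -/
lemma lagrangian_growth {y : Vec m} (hy : P.IsKKT xs y) (z : Vec n) :
    P.f xs + norm1 y * P.muMin / 2 * ‖z - xs‖ ^ 2 ≤ P.lagrangian z y := by
  have h1 := H.strong_gradient_le H.xs_mem hy.1 z
  have h2 := H.neg_gradG_mem_subdifferential hy z
  rw [inner_neg_left] at h2
  rw [hy.2.2] at h1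
  rw [lagrangian]
  linarith

lemma isKKT_of_forall_mem {y : Vec m} (hy : ∀ i, 0 ≤ y i) (h0 : inner ℝ y (P.G xs) = 0)
    (hmin : ∀ v ∈ P.X, P.f xs + inner ℝ (P.gradG xs y) xs ≤ P.f v + inner ℝ (P.gradG xs y) v) :
    P.IsKKT xs y := by
  refine ⟨hy, fun z => ?_, h0⟩
  have hconv : ConvexOn ℝ univ (fun v => P.f v + inner ℝ (P.gradG xs y) v) :=
    H.f_conv.add (((innerSL ℝ (P.gradG xs y)).toLinearMap).convexOn convex_univ)
  have h1 : IsMinOn (fun v => P.f v + inner ℝ (P.gradG xs y) v) univ xs := by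
    refine IsMinOn.of_isLocalMinOn_of_convexOn (mem_univ _) ?_ hconv
    rw [isLocalMinOn_univ_iff]
    filter_upwards [H.X_mem_nhds] with v hv using hmin v hv
  have h2 := H.strong_gradient_le H.xs_mem hy z
  have h3 := h1 (mem_univ z)
  have h4 : 0 ≤ norm1 y * P.muMin / 2 * ‖z - xs‖ ^ 2 := by
    have := H.muMin_pos
    have := norm1_nonneg y
    positivity
  simp only [mem_ofPred_eq] at h3
  rw [inner_sub_right] at h2
  simp only [lagrangian, inner_zero_left, add_zero]
  linarith

/-- Source of both `h1` and `h2`: stationarity gives `r ≤ ‖∇G(xs) y‖`, and the unknown `∇G(xs)` is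
replaced by `∇G(x)` at a Lipschitz cost. -/
lemma r_le_mul_norm1 {y : Vec m} (hy : P.IsKKT xs y) {x : Vec n} (hx : x ∈ P.X) :
    P.r ≤ (‖P.gradG x‖ + P.LX * ‖x - xs‖) * norm1 y := by
  have h1 := H.lip.gradG_lipschitz xs H.xs_mem x hx
  have h2 : ‖P.gradG xs‖ ≤ ‖P.gradG x‖ + P.LX * ‖x - xs‖ := by
    rw [norm_sub_rev x xs]
    linarith [norm_le_norm_add_norm_sub' (P.gradG xs) (P.gradG x)]
  calc P.r ≤ ‖P.gradG xs‖ * ‖y‖ := (H.r_le_norm hy).trans (ContinuousLinearMap.le_opNorm _ _)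
    _ ≤ _ := by
      have h3 := norm_le_norm1 y
      have h4 := H.lip.LX_pos
      have h5 := norm_nonneg (P.gradG xs)
      gcongr

lemma norm1_pos {y : Vec m} (hy : P.IsKKT xs y) : 0 < norm1 y := by
  refine (norm1_nonneg y).lt_of_ne fun h => ?_
  have := H.r_le_mul_norm1 hy H.xs_mem
  rw [← h, mul_zero] at this
  exact absurd H.r_pos (not_lt.2 this)

lemma h1_pos {x : Vec n} {β : ℝ} (hβ : 0 < β) : 0 < P.h1 x β := by
  have := H.r_pos
  have := H.lip.LX_pos
  unfold h1
  positivity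

lemma h1_le {y : Vec m} (hy : P.IsKKT xs y) {x : Vec n} (hx : x ∈ P.X) {β : ℝ}
    (hβ : ‖x - xs‖ ^ 2 ≤ 2 * β) : P.h1 x β ≤ norm1 y := by
  have h1 := H.r_le_mul_norm1 hy hx
  have h2 : ‖x - xs‖ ≤ √(2 * β) := Real.le_sqrt_of_sq_le hβ
  have hL := H.lip.LX_pos
  have hY := H.norm1_pos hy
  have h3 : P.r ≤ (‖P.gradG x‖ + P.LX * √(2 * β)) * norm1 y := h1.trans (by gcongr)
  have h4 : 0 < ‖P.gradG x‖ + P.LX * √(2 * β) := by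
    by_contra! h
    nlinarith [H.r_pos]
  rw [Problem.h1, mul_inv_le_iff₀ h4]
  linarith

lemma h2_le {y : Vec m} (hy : P.IsKKT xs y) {x : Vec n} (hx : x ∈ P.X) {β : ℝ}
    (hβ : P.lagrangian x y - P.f xs ≤ β) : P.h2 x β ≤ norm1 y := by
  have hL := H.lip.LX_pos
  have hY := H.norm1_pos hy
  have hr := H.r_pos
  have hmu := H.muMin_pos
  have hβ0 : 0 ≤ β := by linarith [le_lagrangian hy x]
  have hg := H.lagrangian_growth hy x
  set w := √(norm1 y) with hw
  have hw0 : 0 < w := Real.sqrt_pos.2 hY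
  have hw2 : w ^ 2 = norm1 y := Real.sq_sqrt hY.le
  set a := √(β / (2 * P.muMin)) with ha
  have ha0 : 0 ≤ a := Real.sqrt_nonneg _
  have ha2 : a ^ 2 * (2 * P.muMin) = β := by
    rw [ha, Real.sq_sqrt (by positivity)]; field_simp
  have hdist : ‖x - xs‖ * w ≤ 2 * a := by
    refine le_of_sq_le_sq ?_ (by positivity)
    rw [mul_pow, hw2]
    have : norm1 y * P.muMin / 2 * ‖x - xs‖ ^ 2 ≤ a ^ 2 * (2 * P.muMin) := by linarith
    nlinarith
  have h1 := H.r_le_mul_norm1 hy hx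
  have h3 : P.r ≤ ‖P.gradG x‖ * w ^ 2 + 2 * P.LX * a * w := by
    rw [← hw2] at h1
    have : P.LX * w * (‖x - xs‖ * w) ≤ P.LX * w * (2 * a) := by gcongr
    nlinarith
  set p := P.LX / P.r * a with hp
  set q := ‖P.gradG x‖ / P.r with hq
  have hp0 : 0 ≤ p := by positivity
  have hq0 : 0 ≤ q := by positivity
  have h4 : 1 ≤ q * w ^ 2 + 2 * p * w := by
    rw [hp, hq]
    have e : ‖P.gradG x‖ / P.r * w ^ 2 + 2 * (P.LX / P.r * a) * w =
        (‖P.gradG x‖ * w ^ 2 + 2 * P.LX * a * w) / P.r := by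
      field_simp
    rw [e, le_div_iff₀ hr]
    linarith
  -- Divided by `w ^ 2`, `h4` says that `u = w⁻¹` satisfies `u² - 2pu - q ≤ 0`, so `u` is at most
  -- the larger root.
  have h5 : w⁻¹ ≤ p + √(p ^ 2 + q) := by
    have : (w⁻¹ - p) ^ 2 ≤ p ^ 2 + q := by
      have e : (w⁻¹ - p) ^ 2 = (1 - 2 * p * w) / w ^ 2 + p ^ 2 := by
        field_simp
        ring
      rw [e]
      have : (1 - 2 * p * w) / w ^ 2 ≤ q := by
        rw [div_le_iff₀ (by positivity)]; linarith
      linarith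
    linarith [Real.le_sqrt_of_sq_le this]
  have e : P.LX ^ 2 * β / (2 * P.muMin * P.r ^ 2) = p ^ 2 := by
    rw [hp, ← ha2]
    field_simp
  rw [h2, e, ← ha, ← hp, ← hq]
  have h6 : (w⁻¹) ^ 2 ≤ (p + √(p ^ 2 + q)) ^ 2 := by gcongr
  have h7 := inv_anti₀ (by positivity) h6
  rwa [inv_pow, inv_inv, hw2] at h7

lemma kkt_mem_cutSet {y : Vec m} (hy : P.IsKKT xs y) {ρ : ℝ} (hρ : ρ ≤ norm1 y * P.muMin) :
    y ∈ P.cutSet ρ := ⟨⟨hy.1, hρ⟩, H.kkt_mem_Y hy⟩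

end Regular

end Problem

end RAPD

namespace RAPD

open Filter Topology Set

/-! ### The Lyapunov function and its decrease in one inner iteration. -/

namespace Problem.Regular

variable {n m : ℕ} {P : Problem n m} {xs : Vec n}

lemma convexOn_lagrangian (H : P.Regular xs) {y : Vec m} (hy : ∀ i, 0 ≤ y i) :
    ConvexOn ℝ univ (fun x => P.lagrangian x y) := by
  refine H.f_conv.add ⟨convex_univ, fun u hu v hv a b ha hb hab => ?_⟩
  simp only [inner_G, smul_eq_mul]
  rw [Finset.mul_sum, Finset.mul_sum, ← Finset.sum_add_distrib]
  refine Finset.sum_le_sum fun i _ => ?_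
  have h1 := ((H.g_conv i).convexOn fun r => by have := H.mu_pos i; positivity).2 hu hv ha hb hab
  simp only [smul_eq_mul] at h1
  have h2 := mul_le_mul_of_nonneg_left h1 (hy i)
  linarith

end Problem.Regular

/-- The standing assumptions on the problem, its solution and the input of the algorithm. -/
structure Admissible {n m : ℕ} (P : Problem n m) (I : Input n m) (xs : Vec n) : Prop
    extends P.Regular xs where
  sigma_pos : 0 < I.sigmabar
  nu_mem : I.nu0 ∈ Ioo (0 : ℝ) 1
  delta_mem : I.delta ∈ Ioo (0 : ℝ) 1
  x0_mem : I.x0 ∈ P.X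
  y0_mem : I.y0 ∈ P.Y
  rho_nonneg : 0 ≤ I.rho0
  rho_le : ∀ y, P.IsKKT xs y → I.rho0 ≤ norm1 y * P.muMin

/-- The weight `t_{k-1}` of the previous inner iteration. -/
noncomputable def weightPrev {n m : ℕ} (I : Input n m) (a : State n m) : ℝ :=
  a.sigmaPrev / I.sigmabar

/-- The Lyapunov function of the algorithm, relative to the saddle point `(xs, y)`. -/
noncomputable def energy {n m : ℕ} (P : Problem n m) (I : Input n m) (xs : Vec n) (a : State n m)
    (y : Vec m) : ℝ :=
  weightPrev I a ^ 2 / (2 * taubar P I) * ‖xs - a.x‖ ^ 2 + 1 / (2 * I.sigmabar) * ‖y - a.y‖ ^ 2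
    - weightPrev I a * inner ℝ (y - a.y) (P.G a.x - P.G a.xPrev)
    -- The `LG` part absorbs the cross term by Young's inequality; the `nu0` part is a reserve that
    -- turns the previous displacement into a strict decrease one iteration later.
    + weightPrev I a ^ 2 * (P.LG ^ 2 * I.sigmabar / (2 * I.delta) + I.nu0 / (4 * taubar P I))
      * ‖a.x - a.xPrev‖ ^ 2

/-- The properties of the states of a run. -/
structure Invariant {n m : ℕ} (P : Problem n m) (I : Input n m) (xs : Vec n) (a : State n m) :
    Prop where
  x_mem : a.x ∈ P.X
  xPrev_mem : a.xPrev ∈ P.X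
  xBar_mem : a.xBar ∈ P.X
  y_mem : a.y ∈ P.Y
  sigmaPrev_ge : I.sigmabar ≤ a.sigmaPrev
  sigma_ge : a.sigmaPrev ≤ a.sigma
  tau_eq : a.tau = I.sigmabar * taubar P I / a.sigma
  tauPrev_eq : a.tauPrev = I.sigmabar * taubar P I / a.sigmaPrev
  T_nonneg : 0 ≤ a.T
  rho_nonneg : 0 ≤ a.rho
  -- Lets the curvature `rho` compensate the growth of the weight in front of `‖xs - x‖²`.
  weight_sq_le : weight I a ^ 2 - taubar P I * (weight I a * a.rho) ≤ weightPrev I a ^ 2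
  rho_le : ∀ y, P.IsKKT xs y → a.rho ≤ norm1 y * P.muMin
  energy_le : ∀ y, P.IsKKT xs y →
    a.T * (P.lagrangian a.xBar y - P.f xs) + energy P I xs a y ≤ DeltaXY P I
  weight_le : ∀ y, P.IsKKT xs y →
    weight I a ≤ 1 + taubar P I * (norm1 y * P.muMin) * a.k
  counter : (a.k = 0 ∧ a.N = ⊤) ∨ (1 ≤ a.k ∧ 0 < a.rhoHat ∧
    a.rhoHat * a.k ≤ 3 * weight I a / taubar P I ∧ a.N = (newN P I a.rhoHat a.s : ℕ∞))

namespace Admissible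

variable {n m : ℕ} {P : Problem n m} {I : Input n m} {xs : Vec n} (H : Admissible P I xs)

include H

lemma LXY_nonneg : 0 ≤ P.LXY := mul_nonneg H.cbar_pos.le H.lip.LX_pos.le

lemma denom_pos : 0 < P.LXY + P.LG ^ 2 * I.sigmabar / I.delta := by
  have h1 := H.LXY_nonneg
  have h2 := H.lip.LG_pos
  have h3 := H.sigma_pos
  have h4 := H.delta_mem.1
  positivity

lemma taubar_pos : 0 < taubar P I :=
  mul_pos (sub_pos.2 H.nu_mem.2) (inv_pos.2 H.denom_pos)

lemma one_sub_nu_div : (1 - I.nu0) / taubar P I = P.LXY + P.LG ^ 2 * I.sigmabar / I.delta := by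
  have := H.denom_pos
  have h2 : 1 - I.nu0 ≠ 0 := (sub_pos.2 H.nu_mem.2).ne'
  rw [taubar]
  field_simp

lemma Delta_pos : 0 < DeltaXY P I := by
  have := H.taubar_pos
  have := H.sigma_pos
  have := H.DX_pos
  unfold DeltaXY
  positivity

lemma mul_inner_le {a : State n m} (hx : a.x ∈ P.X) (hp : a.xPrev ∈ P.X)
    (hs : 0 ≤ weightPrev I a) (u : Vec m) :
    weightPrev I a * inner ℝ u (P.G a.x - P.G a.xPrev) ≤ I.delta / (2 * I.sigmabar) * ‖u‖ ^ 2
      + weightPrev I a ^ 2 * (P.LG ^ 2 * I.sigmabar / (2 * I.delta)) * ‖a.x - a.xPrev‖ ^ 2 := by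
  have h1 := real_inner_le_norm u (P.G a.x - P.G a.xPrev)
  have h2 := H.lip.G_lipschitz _ hx _ hp
  have hd := H.delta_mem.1
  have hsb := H.sigma_pos
  set w := weightPrev I a
  have h3 : w * inner ℝ u (P.G a.x - P.G a.xPrev) ≤ w * (‖u‖ * (P.LG * ‖a.x - a.xPrev‖)) := by
    refine mul_le_mul_of_nonneg_left (h1.trans ?_) hs
    gcongr
  have h4 : I.delta / (2 * I.sigmabar) * ‖u‖ ^ 2
      + w ^ 2 * (P.LG ^ 2 * I.sigmabar / (2 * I.delta)) * ‖a.x - a.xPrev‖ ^ 2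
      - w * (‖u‖ * (P.LG * ‖a.x - a.xPrev‖)) =
      (I.delta * ‖u‖ - w * P.LG * I.sigmabar * ‖a.x - a.xPrev‖) ^ 2
        / (2 * I.delta * I.sigmabar) := by
    field_simp
    ring
  have h5 : 0 ≤ (I.delta * ‖u‖ - w * P.LG * I.sigmabar * ‖a.x - a.xPrev‖) ^ 2
        / (2 * I.delta * I.sigmabar) := by positivity
  linarith

lemma weightPrev_ge {a : State n m} (ha : I.sigmabar ≤ a.sigmaPrev) : 1 ≤ weightPrev I a := by
  rw [weightPrev, one_le_div H.sigma_pos]; exact ha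

/-- The cross term costs only the fraction `δ` of the dual distance, the rest being covered by the
displacement term. -/
lemma le_energy {a : State n m} (ha : Invariant P I xs a) (y : Vec m) :
    weightPrev I a ^ 2 / (2 * taubar P I) * ‖xs - a.x‖ ^ 2
      + (1 - I.delta) / (2 * I.sigmabar) * ‖y - a.y‖ ^ 2 ≤ energy P I xs a y := by
  have hw := H.weightPrev_ge ha.sigmaPrev_ge
  have h1 := H.mul_inner_le ha.x_mem ha.xPrev_mem (by linarith) (y - a.y)
  have h2 : 0 ≤ weightPrev I a ^ 2 * (I.nu0 / (4 * taubar P I)) * ‖a.x - a.xPrev‖ ^ 2 := by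
    have := H.taubar_pos
    have := H.nu_mem.1
    positivity
  have h3 : (1 - I.delta) / (2 * I.sigmabar) * ‖y - a.y‖ ^ 2 =
    1 / (2 * I.sigmabar) * ‖y - a.y‖ ^ 2 - I.delta / (2 * I.sigmabar) * ‖y - a.y‖ ^ 2 := by ring
  rw [h3, energy]
  linarith

lemma energy_le {a : State n m} (ha : Invariant P I xs a) (y : Vec m) :
    energy P I xs a y ≤ weightPrev I a ^ 2 / (2 * taubar P I) * ‖xs - a.x‖ ^ 2
      + (1 + I.delta) / (2 * I.sigmabar) * ‖y - a.y‖ ^ 2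
      + weightPrev I a ^ 2 * (P.LG ^ 2 * I.sigmabar / I.delta + I.nu0 / (4 * taubar P I))
      * ‖a.x - a.xPrev‖ ^ 2 := by
  have hw := H.weightPrev_ge ha.sigmaPrev_ge
  have h1 := H.mul_inner_le ha.x_mem ha.xPrev_mem (by linarith) (-(y - a.y))
  rw [inner_neg_left, norm_neg] at h1
  have h3 : (1 + I.delta) / (2 * I.sigmabar) * ‖y - a.y‖ ^ 2 =
    1 / (2 * I.sigmabar) * ‖y - a.y‖ ^ 2 + I.delta / (2 * I.sigmabar) * ‖y - a.y‖ ^ 2 := by ring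
  have h4 : P.LG ^ 2 * I.sigmabar / I.delta =
    P.LG ^ 2 * I.sigmabar / (2 * I.delta) + P.LG ^ 2 * I.sigmabar / (2 * I.delta) := by
    have := H.delta_mem.1
    field_simp
    norm_num
  rw [h3, h4, energy]
  linarith

section Step

variable {a b : State n m} (ha : Invariant P I xs a) (hab : InnerStep P I a b)

include ha

lemma sigma_pos' : 0 < a.sigma := by
  linarith [H.sigma_pos, ha.sigmaPrev_ge, ha.sigma_ge]

lemma sigmaPrev_pos : 0 < a.sigmaPrev := by
  linarith [H.sigma_pos, ha.sigmaPrev_ge]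

lemma one_le_weight : 1 ≤ weight I a := by
  rw [weight, one_le_div H.sigma_pos]
  exact ha.sigmaPrev_ge.trans ha.sigma_ge

lemma tau_pos : 0 < a.tau := by
  rw [ha.tau_eq]
  exact div_pos (mul_pos H.sigma_pos H.taubar_pos) (H.sigma_pos' ha)

lemma weight_mul_tau : weight I a * a.tau = taubar P I := by
  have := H.sigma_pos' ha
  have := H.sigma_pos
  rw [ha.tau_eq, weight]
  field_simp

include hab

lemma dual_step {y : Vec m} (hy : y ∈ P.cutSet a.rho) :
    2 * a.sigma * inner ℝ (y - b.y) (P.G a.x)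
      + 2 * a.sigmaPrev * inner ℝ (y - b.y) (P.G a.x - P.G a.xPrev)
      ≤ ‖y - a.y‖ ^ 2 - ‖y - b.y‖ ^ 2 - ‖b.y - a.y‖ ^ 2 := by
  have hs := H.sigma_pos' ha
  set w := a.sigma • P.G a.x + a.sigmaPrev • (P.G a.x - P.G a.xPrev) with hw
  have hz : a.sigma • extrapolation P a = w := by
    rw [extrapolation, smul_sub, smul_smul, smul_smul, mul_add, mul_div_cancel₀ _ hs.ne', hw]
    module
  have h := prox_three_point (φ := fun _ => 0) (c := 1)
    (convexOn_const 0 (Problem.convex_cutSet a.rho)) hab.y_step.1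
    (w := a.y + a.sigma • extrapolation P a)
    (fun v hv => by simpa using hab.y_step.2 v hv) hy
  rw [hz] at h
  have e1 : b.y - (a.y + w) = (b.y - a.y) - w := by module
  have e2 : y - (a.y + w) = (y - a.y) - w := by module
  rw [e1, e2, norm_sub_sq_real (b.y - a.y), norm_sub_sq_real (y - a.y)] at h
  have e3 : y - b.y = (y - a.y) - (b.y - a.y) := by module
  have e4 : inner ℝ (y - b.y) w = a.sigma * inner ℝ (y - b.y) (P.G a.x)
      + a.sigmaPrev * inner ℝ (y - b.y) (P.G a.x - P.G a.xPrev) := by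
    rw [hw, inner_add_right, inner_smul_right, inner_smul_right]
  have e5 : inner ℝ (y - b.y) w = inner ℝ (y - a.y) w - inner ℝ (b.y - a.y) w := by
    rw [e3, inner_sub_left]
  linarith

lemma primal_step {v : Vec n} (hv : v ∈ P.X) :
    P.f b.x + inner ℝ (P.gradG a.x b.y) b.x + weight I a / (2 * taubar P I) * ‖b.x - a.x‖ ^ 2
      + weight I a / (2 * taubar P I) * ‖v - b.x‖ ^ 2
      ≤ P.f v + inner ℝ (P.gradG a.x b.y) v
        + weight I a / (2 * taubar P I) * ‖v - a.x‖ ^ 2 := by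
  have ht := H.tau_pos ha
  have hw := H.one_le_weight ha
  have e : weight I a / (2 * taubar P I) = 1 / (2 * a.tau) := by
    rw [← H.weight_mul_tau ha]
    field_simp
  rw [e]
  have hconv : ConvexOn ℝ P.X (fun v => P.f v + inner ℝ (P.gradG a.x b.y) v) :=
    (H.f_conv.subset (subset_univ _) P.convex_X).add
      (((innerSL ℝ (P.gradG a.x b.y)).toLinearMap).convexOn P.convex_X)
  exact prox_three_point hconv hab.x_step.1 hab.x_step.2 hv

/-- Sum of the dual and the primal three-point inequalities, the latter scaled by the weight. The
smoothness of `G` on `X` is used at `b.x` and its strong convexity at `xs`, both paired with the new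
dual point `b.y`. The momentum terms telescope into the cross terms of `energy`. -/
lemma energy_step {y : Vec m} (hy : P.IsKKT xs y) :
    energy P I xs b y + weight I a * (P.lagrangian b.x y - P.f xs)
      + (1 - I.delta) / (2 * I.sigmabar) * ‖b.y - a.y‖ ^ 2
      + I.nu0 / (4 * taubar P I) * (weight I a ^ 2 * ‖b.x - a.x‖ ^ 2)
      + I.nu0 / (4 * taubar P I) * (weightPrev I a ^ 2 * ‖a.x - a.xPrev‖ ^ 2)
      ≤ energy P I xs a y := by
  have hsb := H.sigma_pos
  have htb := H.taubar_pos
  have hdl := H.delta_mem.1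
  have hw := H.one_le_weight ha
  have hwp := H.weightPrev_ge ha.sigmaPrev_ge
  obtain ⟨⟨hby0, hbr⟩, hbY⟩ := hab.y_step.1
  have h1 := H.dual_step ha hab (H.kkt_mem_cutSet hy (ha.rho_le y hy))
  have h2 := H.primal_step ha hab H.xs_mem
  have h3 := H.strong_gradient_le ha.x_mem hby0 xs
  have h4 := H.le_gradient ha.x_mem hab.x_step.1 hbY
  have h5 := H.inner_G_xs_nonpos hby0
  have h6 := H.mul_inner_le ha.x_mem ha.xPrev_mem (by linarith) (b.y - a.y)
  -- Here the cut acts: `b.y` lies in the cut set, so the Lagrangian at `b.y` has curvature at least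
  -- `a.rho`.
  have h7 : a.rho / 2 * ‖xs - a.x‖ ^ 2 ≤ norm1 b.y * P.muMin / 2 * ‖xs - a.x‖ ^ 2 := by gcongr
  have hbw : weightPrev I b = weight I a := by rw [weightPrev, hab.sigmaPrev_step, weight]
  have e1 : a.sigma = weight I a * I.sigmabar := by rw [weight]; field_simp
  have e2 : a.sigmaPrev = weightPrev I a * I.sigmabar := by rw [weightPrev]; field_simp
  rw [e1, e2] at h1
  have hsq := ha.weight_sq_le
  have hnu := H.one_sub_nu_div
  have hL := H.LXY_nonneg
  rw [inner_sub_right] at h3 h4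
  simp only [energy, hbw, hab.xPrev_step, Problem.lagrangian]
  set t := weight I a
  set tp := weightPrev I a
  have h1' : t * inner ℝ (y - b.y) (P.G a.x) + tp * inner ℝ (y - b.y) (P.G a.x - P.G a.xPrev)
      ≤ 1 / (2 * I.sigmabar) * (‖y - a.y‖ ^ 2 - ‖y - b.y‖ ^ 2 - ‖b.y - a.y‖ ^ 2) := by
    rw [one_div_mul_eq_div, le_div_iff₀ (by positivity)]
    linarith
  have e3 : inner ℝ (y - b.y) (P.G a.x - P.G a.xPrev) =
      inner ℝ (y - a.y) (P.G a.x - P.G a.xPrev) - inner ℝ (b.y - a.y) (P.G a.x - P.G a.xPrev) := by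
    rw [← inner_sub_left]; congr 1; module
  have e4 : inner ℝ y (P.G b.x) = inner ℝ b.y (P.G b.x) + inner ℝ (y - b.y) (P.G a.x)
      + inner ℝ (y - b.y) (P.G b.x - P.G a.x) := by
    rw [add_assoc, ← inner_add_right, add_sub_cancel, ← inner_add_left, add_sub_cancel]
  have h8 : P.f b.x + inner ℝ b.y (P.G b.x) - P.f xs ≤
      (t / (2 * taubar P I) - a.rho / 2) * ‖xs - a.x‖ ^ 2
      - t / (2 * taubar P I) * ‖xs - b.x‖ ^ 2
      - (t / (2 * taubar P I) - P.LXY / 2) * ‖b.x - a.x‖ ^ 2 := by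
    linarith
  have h9 := mul_le_mul_of_nonneg_left h8 (zero_le_one.trans hw)
  have h10 : t * (t / (2 * taubar P I) - a.rho / 2) ≤ tp ^ 2 / (2 * taubar P I) := by
    rw [le_div_iff₀ (by positivity)]
    have : t * (t / (2 * taubar P I) - a.rho / 2) * (2 * taubar P I) =
      t ^ 2 - taubar P I * (t * a.rho) := by field_simp
    linarith
  have h11 := mul_le_mul_of_nonneg_right h10 (sq_nonneg ‖xs - a.x‖)
  -- The definition of `taubar` splits `1 / τ̄` into the `LXY`, `LG` and `nu0` shares. The surplus
  -- is `LXY / 2 * (t * (t - 1))`, nonnegative since `t ≥ 1`.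
  have h12 : t ^ 2 * (P.LG ^ 2 * I.sigmabar / (2 * I.delta) + I.nu0 / (4 * taubar P I))
      + I.nu0 / (4 * taubar P I) * t ^ 2 ≤ t * (t / (2 * taubar P I) - P.LXY / 2) := by
    have e5 : P.LG ^ 2 * I.sigmabar / (2 * I.delta) =
        ((1 - I.nu0) / taubar P I - P.LXY) / 2 := by
      rw [hnu]; field_simp; ring
    have e6 : t * (t / (2 * taubar P I) - P.LXY / 2)
      - (t ^ 2 * (((1 - I.nu0) / taubar P I - P.LXY) / 2 + I.nu0 / (4 * taubar P I))
      + I.nu0 / (4 * taubar P I) * t ^ 2) = P.LXY / 2 * (t * (t - 1)) := by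
      field_simp
      ring
    have : 0 ≤ P.LXY / 2 * (t * (t - 1)) :=
      mul_nonneg (by linarith) (mul_nonneg (by linarith) (by linarith))
    rw [e5]
    linarith
  have h13 := mul_le_mul_of_nonneg_right h12 (sq_nonneg ‖b.x - a.x‖)
  rw [e3] at h1'
  rw [e4]
  have e7 : (1 - I.delta) / (2 * I.sigmabar) * ‖b.y - a.y‖ ^ 2 =
    1 / (2 * I.sigmabar) * ‖b.y - a.y‖ ^ 2
      - I.delta / (2 * I.sigmabar) * ‖b.y - a.y‖ ^ 2 := by ring
  have e8 : t * (t / (2 * taubar P I) * ‖xs - b.x‖ ^ 2) =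
    t ^ 2 / (2 * taubar P I) * ‖xs - b.x‖ ^ 2 := by ring
  rw [e7]
  linarith

end Step

end Admissible

end RAPD

namespace RAPD

open Filter Topology Set

/-! ### Invariants along a run. -/

lemma Problem.gap_nonneg {n m : ℕ} {P : Problem n m} {xs : Vec n} {y : Vec m} (hy : P.IsKKT xs y) (z : Vec n) :
    0 ≤ P.lagrangian z y - P.f xs := sub_nonneg.2 (Problem.le_lagrangian hy z)

namespace Admissible

variable {n m : ℕ} {P : Problem n m} {I : Input n m} {xs : Vec n} (H : Admissible P I xs)

include H

lemma energy_nonneg {a : State n m} (ha : Invariant P I xs a) (y : Vec m) :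
    0 ≤ energy P I xs a y := by
  refine le_trans ?_ (H.le_energy ha y)
  have := H.sigma_pos
  have := H.taubar_pos
  have := sub_pos.2 H.delta_mem.2
  positivity

lemma h1_arg {a : State n m} (ha : Invariant P I xs a) : I.sigmabar * a.tauPrev * DeltaXY P I / a.sigmaPrev =
    taubar P I * DeltaXY P I / weightPrev I a ^ 2 := by
  have := H.sigmaPrev_pos ha
  have := H.sigma_pos
  rw [ha.tauPrev_eq, weightPrev]
  field_simp

section Step

variable {a b : State n m} (ha : Invariant P I xs a) (hab : InnerStep P I a b)

include ha hab

lemma rho_pos : 0 < b.rho := by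
  rw [hab.rho_step, H.h1_arg ha]
  have hw := H.weightPrev_ge ha.sigmaPrev_ge
  have h1 := H.taubar_pos
  have h2 := H.Delta_pos
  refine lt_max_of_lt_right (mul_pos H.muMin_pos (lt_max_of_lt_left (H.h1_pos ?_)))
  positivity

/-- No circularity: the energy estimate of the current state bounds `‖x - xs‖²` for `h1` and the gap
at the average for `h2`, and it used only the earlier cuts. -/
lemma rho_le_mul {y : Vec m} (hy : P.IsKKT xs y) : b.rho ≤ norm1 y * P.muMin := by
  have hw := H.weightPrev_ge ha.sigmaPrev_ge
  have htb := H.taubar_pos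
  have hE := ha.energy_le y hy
  have hg := Problem.gap_nonneg hy a.xBar
  rw [hab.rho_step, H.h1_arg ha, mul_comm (norm1 y)]
  refine max_le ((ha.rho_le y hy).trans_eq (mul_comm _ _))
    (mul_le_mul_of_nonneg_left (max_le ?_ ?_) H.muMin_pos.le)
  · refine H.h1_le hy ha.x_mem ?_
    have h1 := H.le_energy ha y
    have h2 : 0 ≤ (1 - I.delta) / (2 * I.sigmabar) * ‖y - a.y‖ ^ 2 := by
      have := H.sigma_pos
      have := sub_pos.2 H.delta_mem.2
      positivity
    have h3 : weightPrev I a ^ 2 / (2 * taubar P I) * ‖xs - a.x‖ ^ 2 ≤ DeltaXY P I := by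
      have := mul_nonneg ha.T_nonneg hg
      linarith
    rw [norm_sub_rev, mul_div_assoc', le_div_iff₀ (by positivity)]
    rw [div_mul_eq_mul_div, div_le_iff₀ (by positivity)] at h3
    linarith
  · split_ifs with hT
    · exact norm1_nonneg y
    · have hT' : 0 < a.T := lt_of_le_of_ne ha.T_nonneg (Ne.symm hT)
      refine H.h2_le hy ha.xBar_mem ?_
      rw [le_div_iff₀ hT']
      linarith [H.energy_nonneg ha y]

lemma weight_step : weight I b = weight I a * √(1 + b.rho * a.tau) := by
  have h1 := H.tau_pos ha
  have h2 := H.rho_pos ha hab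
  have h3 : 0 < √(1 + b.rho * a.tau) := Real.sqrt_pos.2 (by positivity)
  rw [weight, hab.sigma_step, hab.tau_step, weight]
  field_simp

lemma weight_step_sq : weight I b ^ 2 = weight I a ^ 2 + weight I a * (b.rho * taubar P I) := by
  have h1 := H.tau_pos ha
  have h2 := H.rho_pos ha hab
  rw [H.weight_step ha hab, mul_pow, Real.sq_sqrt (by positivity), ← H.weight_mul_tau ha]
  ring

lemma weight_le_weight : weight I a ≤ weight I b := by
  rw [H.weight_step ha hab]
  have h0 := H.one_le_weight ha
  have h1 := H.tau_pos ha
  have h2 := H.rho_pos ha hab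
  refine le_mul_of_one_le_right (by linarith) (Real.one_le_sqrt.2 ?_)
  have : 0 < b.rho * a.tau := by positivity
  linarith

/-- The quantities `u = 3 t / τ̄` and `v = ρ̂ k` obey the same recursion, `u'² = u² + 3ρu` and `v'²
= v² + 3ρv`, so `v ≤ u` persists. In the first iteration `v'² = 9ρ / τ̄ ≤ 3ρu`. -/
lemma rhoHat_step :
    0 < b.rhoHat ∧ b.rhoHat * b.k ≤ 3 * weight I b / taubar P I := by
  have htb := H.taubar_pos
  have hr := H.rho_pos ha hab
  have hw := H.one_le_weight ha
  have hwb := H.weight_step_sq ha hab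
  have hwb' := H.weight_le_weight ha hab
  have hnn : 0 ≤ 3 * weight I b / taubar P I := div_nonneg (by linarith) htb.le
  have hsq : (3 * weight I b / taubar P I) ^ 2 =
      (3 * weight I a / taubar P I) ^ 2 + 3 * b.rho * (3 * weight I a / taubar P I) := by
    rw [div_pow, mul_pow, hwb]
    field_simp
  rw [hab.rhoHat_step, hab.k_step, newRhoHat]
  rcases ha.counter with ⟨hk, -⟩ | ⟨hk, hp, hle, -⟩
  · have h1 : 0 < b.rho / taubar P I := by positivity
    refine ⟨by rw [if_pos hk]; positivity, ?_⟩
    rw [if_pos hk, hk]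
    simp only [zero_add, Nat.cast_one, mul_one]
    refine le_of_sq_le_sq ?_ hnn
    rw [mul_pow, Real.sq_sqrt h1.le, hsq]
    have h2 : 3 * b.rho * (3 * weight I a / taubar P I) =
      3 ^ 2 * (b.rho / taubar P I) * weight I a := by ring
    rw [h2]
    have h3 : 3 ^ 2 * (b.rho / taubar P I) * 1 ≤ 3 ^ 2 * (b.rho / taubar P I) * weight I a := by
      gcongr
    have := sq_nonneg (3 * weight I a / taubar P I)
    linarith
  · have hk0 : a.k ≠ 0 := by omega
    have hk1 : (0 : ℝ) < a.k := by exact_mod_cast hk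
    rw [if_neg hk0]
    push_cast
    refine ⟨by positivity, ?_⟩
    have e : ∀ q : ℝ, 1 / ((a.k : ℝ) + 1) * q * ((a.k : ℝ) + 1) = q := by
      intro q; field_simp
    rw [e]
    refine Real.sqrt_le_iff.2 ⟨hnn, ?_⟩
    rw [hsq]
    have h1 : 0 ≤ a.rhoHat * a.k := by positivity
    have h2 : (a.rhoHat * a.k) ^ 2 ≤ (3 * weight I a / taubar P I) ^ 2 := by gcongr
    have h3 : 3 * b.rho * (a.rhoHat * a.k) ≤ 3 * b.rho * (3 * weight I a / taubar P I) := by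
      gcongr
    linarith [mul_pow a.rhoHat (a.k : ℝ) 2]

lemma energy_le_of_step {y : Vec m} (hy : P.IsKKT xs y) :
    energy P I xs b y ≤ energy P I xs a y := by
  have h := H.energy_step ha hab hy
  have h1 := mul_nonneg (zero_le_one.trans (H.one_le_weight ha)) (Problem.gap_nonneg hy b.x)
  have h2 := H.sigma_pos
  have h3 := H.taubar_pos
  have h4 := sub_pos.2 H.delta_mem.2
  have h5 := H.nu_mem.1
  have h6 : 0 ≤ (1 - I.delta) / (2 * I.sigmabar) * ‖b.y - a.y‖ ^ 2 := by positivity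
  have h7 : 0 ≤ I.nu0 / (4 * taubar P I) * (weight I a ^ 2 * ‖b.x - a.x‖ ^ 2) := by positivity
  have h8 : 0 ≤ I.nu0 / (4 * taubar P I) * (weightPrev I a ^ 2 * ‖a.x - a.xPrev‖ ^ 2) := by
    positivity
  linarith

theorem invariant_step : Invariant P I xs b := by
  have htb := H.taubar_pos
  have hsb := H.sigma_pos
  have hw := H.one_le_weight ha
  have hwb := H.weight_le_weight ha hab
  have hwsq := H.weight_step_sq ha hab
  have hr := H.rho_pos ha hab
  have ht := H.tau_pos ha
  have hT := ha.T_nonneg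
  have hTt : 0 < a.T + weight I a := by linarith
  have hs3 : 0 < √(1 + b.rho * a.tau) := Real.sqrt_pos.2 (by positivity)
  have hsig : a.sigma ≤ b.sigma := by
    rw [weight, weight] at hwb
    exact (div_le_div_iff_of_pos_right hsb).1 hwb
  have hbw : weightPrev I b = weight I a := by rw [weightPrev, hab.sigmaPrev_step, weight]
  have hbar : b.xBar = (a.T / (a.T + weight I a)) • a.xBar
      + (weight I a / (a.T + weight I a)) • b.x := by
    rw [hab.xBar_step, smul_add, smul_smul, smul_smul, inv_mul_eq_div, inv_mul_eq_div]
  have hc1 : 0 ≤ a.T / (a.T + weight I a) := by positivity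
  have hc2 : 0 ≤ weight I a / (a.T + weight I a) := by positivity
  have hc : a.T / (a.T + weight I a) + weight I a / (a.T + weight I a) = 1 := by
    field_simp
  refine
    { x_mem := hab.x_step.1
      xPrev_mem := by rw [hab.xPrev_step]; exact ha.x_mem
      xBar_mem := by
        rw [hbar]; exact P.convex_X ha.xBar_mem hab.x_step.1 hc1 hc2 hc
      y_mem := hab.y_step.1.2
      sigmaPrev_ge := by rw [hab.sigmaPrev_step]; exact ha.sigmaPrev_ge.trans ha.sigma_ge
      sigma_ge := by rw [hab.sigmaPrev_step]; exact hsig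
      tau_eq := ?_
      tauPrev_eq := by rw [hab.tauPrev_step, hab.sigmaPrev_step]; exact ha.tau_eq
      T_nonneg := by rw [hab.T_step]; exact hTt.le
      rho_nonneg := hr.le
      weight_sq_le := ?_
      rho_le := fun y hy => H.rho_le_mul ha hab hy
      energy_le := fun y hy => ?_
      weight_le := fun y hy => ?_
      counter := Or.inr ⟨by rw [hab.k_step]; omega, (H.rhoHat_step ha hab).1,
        (H.rhoHat_step ha hab).2, by rw [hab.N_step, hab.s_step]⟩ }
  · have := H.sigma_pos' ha
    rw [hab.sigma_step, hab.tau_step, ha.tau_eq]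
    rw [ha.tau_eq] at hs3
    field_simp
  · rw [hwsq, hbw]
    have : weight I a * (b.rho * taubar P I) ≤ weight I b * (b.rho * taubar P I) := by gcongr
    linarith
  · have h1 := (H.convexOn_lagrangian hy.1).2 (mem_univ a.xBar) (mem_univ b.x) hc1 hc2 hc
    rw [← hbar] at h1
    simp only [smul_eq_mul] at h1
    have h2 := mul_le_mul_of_nonneg_left h1 hTt.le
    have h3 : (a.T + weight I a) * (a.T / (a.T + weight I a) * P.lagrangian a.xBar y
        + weight I a / (a.T + weight I a) * P.lagrangian b.x y) =
        a.T * P.lagrangian a.xBar y + weight I a * P.lagrangian b.x y := by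
      field_simp
    have h4 := H.energy_step ha hab hy
    have h5 := ha.energy_le y hy
    have h6 := sub_pos.2 H.delta_mem.2
    have h7 := H.nu_mem.1
    have h8 : 0 ≤ (1 - I.delta) / (2 * I.sigmabar) * ‖b.y - a.y‖ ^ 2 := by positivity
    have h9 : 0 ≤ I.nu0 / (4 * taubar P I) * (weight I a ^ 2 * ‖b.x - a.x‖ ^ 2) := by positivity
    have h10 : 0 ≤ I.nu0 / (4 * taubar P I) * (weightPrev I a ^ 2 * ‖a.x - a.xPrev‖ ^ 2) := by
      positivity
    rw [hab.T_step]
    linarith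
  · have h1 := ha.weight_le y hy
    have h2 := H.rho_le_mul ha hab hy
    -- Since `t'² = t² + t τ̄ρ ≤ (t + τ̄ρ)²`, weights grow at most linearly.
    have h3 : weight I b ≤ weight I a + taubar P I * b.rho := by
      refine le_of_sq_le_sq ?_ (by positivity)
      rw [hwsq]
      have : 0 ≤ weight I a * (b.rho * taubar P I) := by positivity
      have := sq_nonneg (taubar P I * b.rho)
      linarith
    have h4 : taubar P I * b.rho ≤ taubar P I * (norm1 y * P.muMin) := by gcongr
    rw [hab.k_step]
    push_cast
    linarith

end Step

omit H in
lemma energy_epochStart (s : ℕ) (x : Vec n) (y : Vec m) (ρ : ℝ) (hsb : I.sigmabar ≠ 0)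
    (v : Vec m) :
    energy P I xs (epochStart P I s x y ρ) v =
      1 / (2 * taubar P I) * ‖xs - x‖ ^ 2 + 1 / (2 * I.sigmabar) * ‖v - y‖ ^ 2 := by
  simp [energy, epochStart, weightPrev, div_self hsb]

theorem invariant_epochStart (s : ℕ) {x : Vec n} {y : Vec m} {ρ : ℝ} (hx : x ∈ P.X)
    (hy : y ∈ P.Y) (hρ : 0 ≤ ρ) (hρ' : ∀ y, P.IsKKT xs y → ρ ≤ norm1 y * P.muMin) :
    Invariant P I xs (epochStart P I s x y ρ) := by
  have htb := H.taubar_pos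
  have hsb := H.sigma_pos
  refine
    { x_mem := hx
      xPrev_mem := hx
      xBar_mem := hx
      y_mem := hy
      sigmaPrev_ge := le_rfl
      sigma_ge := le_rfl
      tau_eq := by simp only [epochStart]; field_simp
      tauPrev_eq := by simp only [epochStart]; field_simp
      T_nonneg := le_rfl
      rho_nonneg := hρ
      weight_sq_le := ?_
      rho_le := hρ'
      energy_le := fun v hv => ?_
      weight_le := fun v hv => ?_
      counter := Or.inl ⟨rfl, rfl⟩ }
  · simp only [weight, weightPrev, epochStart, div_self hsb.ne']
    have : 0 ≤ taubar P I * (1 * ρ) := by positivity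
    linarith
  · rw [energy_epochStart _ _ _ _ hsb.ne']
    have h1 := Problem.norm_sub_le_DX H.xs_mem hx
    have h2 := Problem.norm_sub_le_DY (H.kkt_mem_Y hv) hy
    have h3 : 1 / (2 * taubar P I) * ‖xs - x‖ ^ 2 ≤ 1 / taubar P I * P.DX ^ 2 := by
      gcongr
      linarith
    have h4 : 1 / (2 * I.sigmabar) * ‖v - y‖ ^ 2 ≤ 1 / (2 * I.sigmabar) * P.DY ^ 2 := by
      gcongr
    have h5 : (epochStart P I s x y ρ).T = 0 := rfl
    rw [h5, DeltaXY]
    linarith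
  · simp [weight, epochStart, div_self hsb.ne']

theorem invariant_run {st : ℕ → State n m} (hrun : IsRun P I st) (j : ℕ) :
    Invariant P I xs (st j) := by
  induction j with
  | zero =>
    rw [hrun.1]
    exact H.invariant_epochStart 0 H.x0_mem H.y0_mem H.rho_nonneg H.rho_le
  | succ j ih =>
    rcases hrun.2 j with ⟨-, h⟩ | ⟨-, h⟩
    · exact H.invariant_step ih h
    · rw [h]
      exact H.invariant_epochStart _ ih.x_mem ih.y_mem ih.rho_nonneg ih.rho_le

end Admissible

end RAPD

namespace RAPD

open Filter Topology Set

/-! ### Small residuals force small energy. -/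

lemma tendsto_zero_of_sq_le {u R : ℕ → ℝ} (h : ∀ k, u k ^ 2 ≤ R k) (hR : Tendsto R atTop (𝓝 0)) :
    Tendsto u atTop (𝓝 0) := by
  have h1 : Tendsto (fun k => √(R k)) atTop (𝓝 0) := by
    simpa using hR.sqrt
  exact squeeze_zero_norm (fun k => Real.abs_le_sqrt (h k)) h1

lemma tendsto_sum_one_div_atTop {c : ℝ} (hc : 0 ≤ c) :
    Tendsto (fun k : ℕ => ∑ i ∈ Finset.range k, 1 / (1 + c * (i : ℝ))) atTop atTop := by
  have h1 := Real.tendsto_sum_range_one_div_nat_succ_atTop.const_mul_atTop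
    (show (0 : ℝ) < (1 + c)⁻¹ by positivity)
  refine tendsto_atTop_mono (fun k => ?_) h1
  rw [Finset.mul_sum]
  refine Finset.sum_le_sum fun i _ => ?_
  rw [← one_div, one_div_mul_one_div]
  refine one_div_le_one_div_of_le (by positivity) ?_
  have : (0 : ℝ) ≤ i := Nat.cast_nonneg i
  nlinarith

/-- The size of an inner iteration, together with the distance of the new point to `xs`. -/
noncomputable def residual {n m : ℕ} (I : Input n m) (xs : Vec n) (a b : State n m) : ℝ :=
  weight I a ^ 2 * ‖xs - b.x‖ ^ 2 + weight I a ^ 2 * ‖b.x - a.x‖ ^ 2 + ‖b.y - a.y‖ ^ 2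
    + weightPrev I a ^ 2 * ‖a.x - a.xPrev‖ ^ 2

namespace Admissible

variable {n m : ℕ} {P : Problem n m} {I : Input n m} {xs : Vec n} (H : Admissible P I xs)

include H

/-- Approximate complementarity: the dual inequality divided by `a.sigma`. The constants do not
depend on the possibly unbounded step sizes, because `a.sigma` is at least both `sigmabar` and
`a.sigmaPrev`. -/
lemma inner_le_of_dual_step {a b : State n m} (ha : Invariant P I xs a)
    (hab : InnerStep P I a b) {y : Vec m} (hy : P.IsKKT xs y) :
    inner ℝ (y - b.y) (P.G a.x) ≤
      P.DY / I.sigmabar * ‖b.y - a.y‖ + P.DY * P.LG * ‖a.x - a.xPrev‖ := by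
  have h1 := H.dual_step ha hab (H.kkt_mem_cutSet hy (ha.rho_le y hy))
  have hs := H.sigma_pos' ha
  have hsp := H.sigmaPrev_pos ha
  have hsb := H.sigma_pos
  have hD := H.DY_pos
  have hLG := H.lip.LG_pos
  have h2 : ‖y - a.y‖ ≤ ‖y - b.y‖ + ‖b.y - a.y‖ := norm_sub_le_norm_sub_add_norm_sub _ _ _
  have h3 := Problem.norm_sub_le_DY (H.kkt_mem_Y hy) hab.y_step.1.2
  have h4 : ‖y - a.y‖ ^ 2 ≤ (‖y - b.y‖ + ‖b.y - a.y‖) ^ 2 := by gcongr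
  have h5 : ‖y - b.y‖ * ‖b.y - a.y‖ ≤ P.DY * ‖b.y - a.y‖ := by gcongr
  have h6 : -inner ℝ (y - b.y) (P.G a.x - P.G a.xPrev) ≤ P.DY * (P.LG * ‖a.x - a.xPrev‖) := by
    have h := H.lip.G_lipschitz _ ha.x_mem _ ha.xPrev_mem
    calc -inner ℝ (y - b.y) (P.G a.x - P.G a.xPrev) ≤ ‖y - b.y‖ * ‖P.G a.x - P.G a.xPrev‖ :=
          (neg_le_abs _).trans (abs_real_inner_le_norm _ _)
      _ ≤ _ := by gcongr
  have h7 : a.sigma * inner ℝ (y - b.y) (P.G a.x) ≤ P.DY * ‖b.y - a.y‖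
      + a.sigmaPrev * (P.DY * (P.LG * ‖a.x - a.xPrev‖)) := by
    have := mul_le_mul_of_nonneg_left h6 hsp.le
    linarith
  have h8 : a.sigmaPrev * (P.DY * (P.LG * ‖a.x - a.xPrev‖)) ≤
      a.sigma * (P.DY * (P.LG * ‖a.x - a.xPrev‖)) := by
    have := ha.sigma_ge
    gcongr
  have h9 : P.DY * ‖b.y - a.y‖ ≤ a.sigma * (P.DY / I.sigmabar * ‖b.y - a.y‖) := by
    have : I.sigmabar * (P.DY / I.sigmabar * ‖b.y - a.y‖) = P.DY * ‖b.y - a.y‖ := by field_simp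
    rw [← this]
    have := ha.sigmaPrev_ge.trans ha.sigma_ge
    gcongr
  refine le_of_mul_le_mul_left ?_ hs
  linarith

/-- Approximate stationarity. The error carries the weight, which is why `residual` measures
displacements with squared weights. -/
lemma objective_le_of_primal_step {a b : State n m} (ha : Invariant P I xs a)
    (hab : InnerStep P I a b) {v : Vec n} (hv : v ∈ P.X) :
    P.f b.x + inner ℝ (P.gradG a.x b.y) b.x ≤ P.f v + inner ℝ (P.gradG a.x b.y) v
      + P.DX / taubar P I * (weight I a * ‖b.x - a.x‖) := by
  have h1 := H.primal_step ha hab hv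
  have htb := H.taubar_pos
  have hw := H.one_le_weight ha
  have h2 : ‖v - a.x‖ ≤ ‖v - b.x‖ + ‖b.x - a.x‖ := norm_sub_le_norm_sub_add_norm_sub _ _ _
  have h3 := Problem.norm_sub_le_DX hv hab.x_step.1
  have h4 : ‖v - a.x‖ ^ 2 ≤ (‖v - b.x‖ + ‖b.x - a.x‖) ^ 2 := by gcongr
  have h5 : ‖v - b.x‖ * ‖b.x - a.x‖ ≤ P.DX * ‖b.x - a.x‖ := by gcongr
  have h6 : ‖v - a.x‖ ^ 2 - ‖v - b.x‖ ^ 2 - ‖b.x - a.x‖ ^ 2 ≤ 2 * (P.DX * ‖b.x - a.x‖) := by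
    linarith
  have h7 := mul_le_mul_of_nonneg_left h6
    (show 0 ≤ weight I a / (2 * taubar P I) by positivity)
  have h8 : weight I a / (2 * taubar P I) * (2 * (P.DX * ‖b.x - a.x‖)) =
      P.DX / taubar P I * (weight I a * ‖b.x - a.x‖) := by field_simp
  linarith

/-- A cluster point of dual iterates along which the residual vanishes is a multiplier. -/
lemma isKKT_of_tendsto {a b : ℕ → State n m} (ha : ∀ k, Invariant P I xs (a k))
    (hab : ∀ k, InnerStep P I (a k) (b k))
    (hR : Tendsto (fun k => residual I xs (a k) (b k)) atTop (𝓝 0)) {y : Vec m}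
    (hy : Tendsto (fun k => (b k).y) atTop (𝓝 y)) : P.IsKKT xs y := by
  have hw := fun k => H.one_le_weight (ha k)
  have hwp := fun k => H.weightPrev_ge (ha k).sigmaPrev_ge
  have sq_le : ∀ {w u : ℝ}, 1 ≤ w → 0 ≤ u → u ^ 2 ≤ w ^ 2 * u ^ 2 := fun {w u} h1 h2 =>
    le_mul_of_one_le_left (sq_nonneg u) (one_le_pow₀ h1)
  have hn : ∀ k, 0 ≤ weight I (a k) ^ 2 * ‖xs - (b k).x‖ ^ 2 ∧
      0 ≤ weight I (a k) ^ 2 * ‖(b k).x - (a k).x‖ ^ 2 ∧ 0 ≤ ‖(b k).y - (a k).y‖ ^ 2 ∧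
      0 ≤ weightPrev I (a k) ^ 2 * ‖(a k).x - (a k).xPrev‖ ^ 2 := fun k =>
    ⟨by positivity, by positivity, by positivity, by positivity⟩
  have hbx : Tendsto (fun k => ‖xs - (b k).x‖) atTop (𝓝 0) :=
    tendsto_zero_of_sq_le (fun k => by
      have := sq_le (hw k) (norm_nonneg (xs - (b k).x))
      obtain ⟨h1, h2, h3, h4⟩ := hn k
      rw [residual]; linarith) hR
  have hdx : Tendsto (fun k => weight I (a k) * ‖(b k).x - (a k).x‖) atTop (𝓝 0) :=
    tendsto_zero_of_sq_le (fun k => by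
      obtain ⟨h1, h2, h3, h4⟩ := hn k
      rw [residual, mul_pow]; linarith) hR
  have hdx' : Tendsto (fun k => ‖(b k).x - (a k).x‖) atTop (𝓝 0) :=
    squeeze_zero (fun k => norm_nonneg _)
      (fun k => le_mul_of_one_le_left (norm_nonneg _) (hw k)) hdx
  have hdy : Tendsto (fun k => ‖(b k).y - (a k).y‖) atTop (𝓝 0) :=
    tendsto_zero_of_sq_le (fun k => by
      obtain ⟨h1, h2, h3, h4⟩ := hn k
      rw [residual]; linarith) hR
  have hdp : Tendsto (fun k => ‖(a k).x - (a k).xPrev‖) atTop (𝓝 0) :=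
    tendsto_zero_of_sq_le (fun k => by
      have := sq_le (hwp k) (norm_nonneg ((a k).x - (a k).xPrev))
      obtain ⟨h1, h2, h3, h4⟩ := hn k
      rw [residual]; linarith) hR
  have hbx' : Tendsto (fun k => (b k).x) atTop (𝓝 xs) := by
    rw [tendsto_iff_norm_sub_tendsto_zero]
    simpa only [norm_sub_rev] using hbx
  have hax : Tendsto (fun k => (a k).x) atTop (𝓝 xs) := by
    have := hbx'.sub (tendsto_zero_iff_norm_tendsto_zero.2 hdx')
    simpa using this
  have hgrad : Tendsto (fun k => P.gradG (a k).x) atTop (𝓝 (P.gradG xs)) := by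
    rw [tendsto_iff_norm_sub_tendsto_zero]
    refine squeeze_zero (fun k => norm_nonneg _)
      (fun k => H.lip.gradG_lipschitz _ (ha k).x_mem _ H.xs_mem) ?_
    simpa using (tendsto_iff_norm_sub_tendsto_zero.1 hax).const_mul P.LX
  have hgy : Tendsto (fun k => P.gradG (a k).x (b k).y) atTop (𝓝 (P.gradG xs y)) :=
    (isBoundedBilinearMap_apply.continuous.tendsto (P.gradG xs, y)).comp (hgrad.prodMk_nhds hy)
  have hy0 : ∀ i, 0 ≤ y i := fun i =>
    ge_of_tendsto' (((EuclideanSpace.proj i : Vec m →L[ℝ] ℝ).continuous.tendsto y).comp hy)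
      fun k => (hab k).y_step.1.1.1 i
  refine H.isKKT_of_forall_mem hy0 (le_antisymm (H.inner_G_xs_nonpos hy0) ?_) fun v hv => ?_
  -- Complementarity is tested against a true multiplier: it lies in every cut set, and its own
  -- product with `G(xs)` vanishes.
  · obtain ⟨y1, hy1⟩ := H.exists_kkt
    have hl : Tendsto (fun k => inner ℝ (y1 - (b k).y) (P.G (a k).x)) atTop
        (𝓝 (inner ℝ (y1 - y) (P.G xs))) :=
      (hy.const_sub y1).inner ((H.continuous_G.tendsto xs).comp hax)
    have hr : Tendsto (fun k => P.DY / I.sigmabar * ‖(b k).y - (a k).y‖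
        + P.DY * P.LG * ‖(a k).x - (a k).xPrev‖) atTop
        (𝓝 (P.DY / I.sigmabar * 0 + P.DY * P.LG * 0)) :=
      (hdy.const_mul _).add (hdp.const_mul _)
    have h := le_of_tendsto_of_tendsto' hl hr
      fun k => H.inner_le_of_dual_step (ha k) (hab k) hy1
    rw [inner_sub_left, hy1.2.2] at h
    linarith
  · have hl : Tendsto (fun k => P.f (b k).x + inner ℝ (P.gradG (a k).x (b k).y) (b k).x) atTop
        (𝓝 (P.f xs + inner ℝ (P.gradG xs y) xs)) :=
      ((H.f_cont.tendsto xs).comp hbx').add (hgy.inner hbx')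
    have hr : Tendsto (fun k => P.f v + inner ℝ (P.gradG (a k).x (b k).y) v
        + P.DX / taubar P I * (weight I (a k) * ‖(b k).x - (a k).x‖)) atTop
        (𝓝 (P.f v + inner ℝ (P.gradG xs y) v + P.DX / taubar P I * 0)) :=
      ((hgy.inner tendsto_const_nhds).const_add _).add (hdx.const_mul _)
    have h := le_of_tendsto_of_tendsto' hl hr
      fun k => H.objective_le_of_primal_step (ha k) (hab k) hv
    linarith

lemma energy_le_residual {a b : State n m} (ha : Invariant P I xs a) (hab : InnerStep P I a b)
    (y : Vec m) :
    energy P I xs b y ≤ (1 / (2 * taubar P I) + (P.LG ^ 2 * I.sigmabar / I.delta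
      + I.nu0 / (4 * taubar P I))) * residual I xs a b
      + (1 + I.delta) / (2 * I.sigmabar) * ‖y - b.y‖ ^ 2 := by
  have h := H.energy_le (H.invariant_step ha hab) y
  have hbw : weightPrev I b = weight I a := by rw [weightPrev, hab.sigmaPrev_step, weight]
  rw [hbw, hab.xPrev_step] at h
  have h1 := H.taubar_pos
  have h2 := H.sigma_pos
  have h3 := H.delta_mem.1
  have h4 := H.nu_mem.1
  have n1 : 0 ≤ weight I a ^ 2 * ‖xs - b.x‖ ^ 2 := by positivity
  have n2 : 0 ≤ weight I a ^ 2 * ‖b.x - a.x‖ ^ 2 := by positivity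
  have n3 : 0 ≤ weightPrev I a ^ 2 * ‖a.x - a.xPrev‖ ^ 2 := by positivity
  have h5 : weight I a ^ 2 * ‖xs - b.x‖ ^ 2 ≤ residual I xs a b := by
    have := sq_nonneg ‖b.y - a.y‖
    rw [residual]; linarith
  have h6 : weight I a ^ 2 * ‖b.x - a.x‖ ^ 2 ≤ residual I xs a b := by
    have := sq_nonneg ‖b.y - a.y‖
    rw [residual]; linarith
  have h7 := mul_le_mul_of_nonneg_left h5 (show 0 ≤ 1 / (2 * taubar P I) by positivity)
  have h8 := mul_le_mul_of_nonneg_left h6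
    (show 0 ≤ P.LG ^ 2 * I.sigmabar / I.delta + I.nu0 / (4 * taubar P I) by positivity)
  have e : weight I a ^ 2 / (2 * taubar P I) * ‖xs - b.x‖ ^ 2 =
    1 / (2 * taubar P I) * (weight I a ^ 2 * ‖xs - b.x‖ ^ 2) := by ring
  rw [e] at h
  linarith

/-- After an inner iteration with small residual, some multiplier has small energy. -/
lemma exists_energy_le_of_residual_le {ε : ℝ} (hε : 0 < ε) :
    ∃ η > 0, ∀ a b, Invariant P I xs a → InnerStep P I a b → residual I xs a b ≤ η →
      ∃ y, P.IsKKT xs y ∧ energy P I xs b y ≤ ε := by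
  by_contra! hcon
  -- The states are arbitrary and need not come from one run, so `η` is uniform over all epochs.
  choose a b ha hab hle hgt using fun k : ℕ =>
    hcon (1 / ((k : ℝ) + 1)) Nat.one_div_pos_of_nat
  have hR : Tendsto (fun k => residual I xs (a k) (b k)) atTop (𝓝 0) :=
    squeeze_zero (fun k => by unfold residual; positivity) hle
      tendsto_one_div_add_atTop_nhds_zero_nat
  obtain ⟨y, -, φ, hφ, hy⟩ := P.isCompact_Y.tendsto_subseq fun k => (hab k).y_step.1.2
  have hRφ := hR.comp hφ.tendsto_atTop
  have hkkt := H.isKKT_of_tendsto (fun k => ha (φ k)) (fun k => hab (φ k)) hRφ hy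
  have hlim := (hRφ.const_mul (1 / (2 * taubar P I) + (P.LG ^ 2 * I.sigmabar / I.delta
      + I.nu0 / (4 * taubar P I)))).add
    ((((hy.const_sub y).norm).pow 2).const_mul ((1 + I.delta) / (2 * I.sigmabar)))
  -- The cluster point `y` is itself a multiplier, and the energy relative to it tends to zero along
  -- the subsequence, contradicting `hgt`.
  have h0 := ge_of_tendsto' hlim fun k => ((hgt (φ k) y hkkt).le.trans
    (H.energy_le_residual (ha (φ k)) (hab (φ k)) y))
  simp at h0
  linarith

/-- The gap controls only `t * ‖xs - b.x‖²`, while `residual` contains `t² * ‖xs - b.x‖²`; hence the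
factor `1 / t`. -/
lemma exists_energy_decrease {y : Vec m} (hy : P.IsKKT xs y) :
    ∃ κ > 0, ∀ a b, Invariant P I xs a → InnerStep P I a b →
      energy P I xs b y + κ * (residual I xs a b * (1 / weight I a)) ≤ energy P I xs a y := by
  have h1 := H.taubar_pos
  have h2 := H.sigma_pos
  have h3 := sub_pos.2 H.delta_mem.2
  have h4 := H.nu_mem.1
  have h5 := H.norm1_pos hy
  have h6 := H.muMin_pos
  set κ := min (norm1 y * P.muMin / 2) (min ((1 - I.delta) / (2 * I.sigmabar))
    (I.nu0 / (4 * taubar P I))) with hκ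
  have hκ0 : 0 < κ := by positivity
  have k1 : κ ≤ norm1 y * P.muMin / 2 := min_le_left _ _
  have k2 : κ ≤ (1 - I.delta) / (2 * I.sigmabar) := (min_le_right _ _).trans (min_le_left _ _)
  have k3 : κ ≤ I.nu0 / (4 * taubar P I) := (min_le_right _ _).trans (min_le_right _ _)
  refine ⟨κ, hκ0, fun a b ha hab => ?_⟩
  have hs := H.energy_step ha hab hy
  have hg := H.lagrangian_growth hy b.x
  have hw := H.one_le_weight ha
  have hw0 : 0 < weight I a := by linarith
  have hinv : 1 / weight I a ≤ 1 := by rw [div_le_one hw0]; exact hw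
  have le1 : ∀ {u c : ℝ}, 0 ≤ u → κ ≤ c → κ * (u * (1 / weight I a)) ≤ c * u := by
    intro u c hu hc
    have : u * (1 / weight I a) ≤ u := mul_le_of_le_one_right hu hinv
    have hc0 : 0 ≤ c := hκ0.le.trans hc
    gcongr
  have r1 : κ * (weight I a ^ 2 * ‖xs - b.x‖ ^ 2 * (1 / weight I a)) ≤
      weight I a * (P.lagrangian b.x y - P.f xs) := by
    have e : κ * (weight I a ^ 2 * ‖xs - b.x‖ ^ 2 * (1 / weight I a)) =
        weight I a * (κ * ‖b.x - xs‖ ^ 2) := by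
      rw [norm_sub_rev]; field_simp
    rw [e]
    refine mul_le_mul_of_nonneg_left ?_ hw0.le
    have : κ * ‖b.x - xs‖ ^ 2 ≤ norm1 y * P.muMin / 2 * ‖b.x - xs‖ ^ 2 := by gcongr
    linarith
  have r2 := le1 (u := weight I a ^ 2 * ‖b.x - a.x‖ ^ 2) (by positivity) k3
  have r3 := le1 (u := ‖b.y - a.y‖ ^ 2) (by positivity) k2
  have r4 := le1 (u := weightPrev I a ^ 2 * ‖a.x - a.xPrev‖ ^ 2) (by positivity) k3
  have e : κ * (residual I xs a b * (1 / weight I a)) =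
      κ * (weight I a ^ 2 * ‖xs - b.x‖ ^ 2 * (1 / weight I a))
      + κ * (weight I a ^ 2 * ‖b.x - a.x‖ ^ 2 * (1 / weight I a))
      + κ * (‖b.y - a.y‖ ^ 2 * (1 / weight I a))
      + κ * (weightPrev I a ^ 2 * ‖a.x - a.xPrev‖ ^ 2 * (1 / weight I a)) := by
    rw [residual]; ring
  rw [e]
  linarith

/-! ### Epochs, restarts and limit points. -/

variable {st : ℕ → State n m} (hrun : IsRun P I st)

include hrun

/-- Late in an epoch, some multiplier has small energy. -/
theorem exists_energy_le_of_le_k {ε : ℝ} (hε : 0 < ε) :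
    ∃ K : ℕ, ∀ j, K ≤ (st j).k → ∃ y, P.IsKKT xs y ∧ energy P I xs (st j) y ≤ ε := by
  obtain ⟨η, hη, hgood⟩ := H.exists_energy_le_of_residual_le hε
  obtain ⟨y1, hy1⟩ := H.exists_kkt
  obtain ⟨κ, hκ, hdec⟩ := H.exists_energy_decrease hy1
  set c := taubar P I * (norm1 y1 * P.muMin) with hc
  have hc0 : 0 < c := mul_pos H.taubar_pos (mul_pos (H.norm1_pos hy1) H.muMin_pos)
  have hE : ∀ a, Invariant P I xs a → energy P I xs a y1 ≤ DeltaXY P I := fun a ha => by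
    have := ha.energy_le y1 hy1
    have := mul_nonneg ha.T_nonneg (Problem.gap_nonneg hy1 a.xBar)
    linarith
  have hinv := H.invariant_run hrun
  -- Either a small residual has already occurred in the current epoch, or each of its iterations
  -- spent at least `κ * η / (1 + c * i)` of a budget `DeltaXY` that is the same for every epoch.
  have key : ∀ j, (∃ y, P.IsKKT xs y ∧ energy P I xs (st j) y ≤ ε) ∨
      energy P I xs (st j) y1
        + κ * η * ∑ i ∈ Finset.range (st j).k, 1 / (1 + c * (i : ℝ)) ≤ DeltaXY P I := by
    intro j
    induction j with
    | zero =>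
      right
      have hk : (st 0).k = 0 := by rw [hrun.1]; rfl
      rw [hk]
      simpa using hE _ (hinv 0)
    | succ j ih =>
      rcases hrun.2 j with ⟨-, h⟩ | ⟨-, h⟩
      · rcases ih with ⟨y, hy, hle⟩ | ih
        · exact Or.inl ⟨y, hy, (H.energy_le_of_step (hinv j) h hy).trans hle⟩
        · rcases le_or_gt (residual I xs (st j) (st (j + 1))) η with hr | hr
          · exact Or.inl (hgood _ _ (hinv j) h hr)
          · right
            have h1 := hdec _ _ (hinv j) h
            have hw := (hinv j).weight_le y1 hy1
            have hw1 := H.one_le_weight (hinv j)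
            have h2 : κ * (η * (1 / (1 + c * ((st j).k : ℝ)))) ≤
                κ * (residual I xs (st j) (st (j + 1)) * (1 / weight I (st j))) := by
              have hw0 : 0 < weight I (st j) := by linarith
              have : 1 / (1 + c * ((st j).k : ℝ)) ≤ 1 / weight I (st j) :=
                one_div_le_one_div_of_le hw0 hw
              have : 0 ≤ residual I xs (st j) (st (j + 1)) := (lt_trans hη hr).le
              gcongr
            rw [h.k_step, Finset.sum_range_succ]
            linarith
      · right
        have hk : (st (j + 1)).k = 0 := by rw [h]; rfl
        rw [hk]
        simpa using hE _ (hinv (j + 1))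
  obtain ⟨K, hK⟩ := ((tendsto_sum_one_div_atTop hc0.le).eventually_gt_atTop
    (DeltaXY P I / (κ * η))).exists_forall_of_atTop
  refine ⟨K, fun j hj => (key j).resolve_right fun hcon => ?_⟩
  have h1 := hK _ hj
  rw [div_lt_iff₀ (by positivity)] at h1
  have h2 := H.energy_nonneg (hinv j) y1
  linarith

/-- The epochs become arbitrarily long. -/
theorem exists_le_k_of_epoch_end (K : ℕ) :
    ∃ s₀ : ℕ, ∀ j, s₀ ≤ (st j).s → (st j).N ≤ ((st j).k : ℕ∞) → K ≤ (st j).k := by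
  obtain ⟨y1, hy1⟩ := H.exists_kkt
  set c := taubar P I * (norm1 y1 * P.muMin) with hc
  have hc0 : 0 < c := mul_pos H.taubar_pos (mul_pos (H.norm1_pos hy1) H.muMin_pos)
  have htb := H.taubar_pos
  have hsb := H.sigma_pos
  have hDX := H.DX_pos
  have hDY := H.DY_pos
  set A := 3 * √2 * P.DY / (P.DX * √(taubar P I * I.sigmabar)) with hA
  have hA0 : 0 < A := by positivity
  have h2 : (1 : ℝ) < √2 := by
    rw [Real.lt_sqrt zero_le_one]; norm_num
  obtain ⟨s₀, hs₀⟩ := pow_unbounded_of_one_lt (3 * (1 + c * K) / taubar P I / A) h2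
  refine ⟨s₀, fun j hj hN => ?_⟩
  have ha := H.invariant_run hrun j
  rcases ha.counter with ⟨-, h⟩ | ⟨-, hp, hle, h⟩
  · rw [h] at hN
    simp at hN
  · rw [h, Nat.cast_le] at hN
    -- The stopping rule gives `√2 ^ s * A ≤ rhoHat * k ≤ 3 t / τ̄`, and `t ≤ 1 + c k` then forces
    -- `k` to grow with `s`.
    have h3 : (√2) ^ (st j).s * (3 * √2 * P.DY /
        ((st j).rhoHat * P.DX * √(taubar P I * I.sigmabar))) ≤ (st j).k :=
      (le_max_right _ _).trans (Nat.ceil_le.1 hN)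
    have h4 : 3 * √2 * P.DY / ((st j).rhoHat * P.DX * √(taubar P I * I.sigmabar)) =
        A / (st j).rhoHat := by
      rw [hA]; field_simp
    rw [h4, mul_div_assoc', div_le_iff₀ hp] at h3
    have h5 : (√2) ^ s₀ ≤ (√2) ^ (st j).s := pow_le_pow_right₀ h2.le hj
    have h6 : 3 * (1 + c * K) / taubar P I < (√2) ^ s₀ * A := by
      rwa [div_lt_iff₀ hA0] at hs₀
    have h7 : (√2) ^ s₀ * A ≤ (√2) ^ (st j).s * A := by gcongr
    have h8 := ha.weight_le y1 hy1
    have h9 : 3 * weight I (st j) / taubar P I ≤ 3 * (1 + c * (st j).k) / taubar P I := by gcongr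
    have h10 : 3 * (1 + c * K) / taubar P I < 3 * (1 + c * (st j).k) / taubar P I := by linarith
    rw [div_lt_div_iff_of_pos_right htb] at h10
    have h11 : c * K < c * (st j).k := by linarith
    have h12 : (K : ℝ) < (st j).k := lt_of_mul_lt_mul_left h11 hc0.le
    exact_mod_cast h12.le

omit H in
/-- Either the epochs or the inner iterations are eventually late. -/
lemma eventually_epoch_or_inner (s₁ K : ℕ) :
    ∀ᶠ j in atTop, s₁ ≤ (st j).s ∨ K ≤ (st j).k := by
  have hmono : Monotone fun j => (st j).s := monotone_nat_of_le_succ fun j => by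
    rcases hrun.2 j with ⟨-, h⟩ | ⟨-, h⟩
    · exact h.s_step.ge
    · have : (st (j + 1)).s = (st j).s + 1 := by rw [h]; rfl
      omega
  by_cases hb : ∃ j, s₁ ≤ (st j).s
  · obtain ⟨j₀, hj₀⟩ := hb
    filter_upwards [eventually_ge_atTop j₀] with j hj using Or.inl (hj₀.trans (hmono hj))
  · push Not at hb
    -- `N_s` is recomputed in every iteration, so an epoch might never end. If the epoch index is
    -- bounded, no restart occurs after its maximum is reached, and `k` increases forever.
    obtain ⟨j₀, hj₀⟩ := Nat.sSup_mem (range_nonempty fun j => (st j).s)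
      ⟨s₁, by rintro _ ⟨j, rfl⟩; exact (hb j).le⟩
    have hmax : ∀ j, (st j).s ≤ (st j₀).s := fun j => by
      refine le_of_le_of_eq ?_ hj₀.symm
      exact le_csSup ⟨s₁, by rintro _ ⟨j, rfl⟩; exact (hb j).le⟩ (mem_range_self j)
    have hk : ∀ i, i ≤ (st (j₀ + i)).k := by
      intro i
      induction i with
      | zero => exact Nat.zero_le _
      | succ i ih =>
        rcases hrun.2 (j₀ + i) with ⟨-, h⟩ | ⟨-, h⟩
        · have := h.k_step
          rw [← add_assoc, this]
          omega
        · have h1 : (st (j₀ + i + 1)).s = (st (j₀ + i)).s + 1 := by rw [h]; rfl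
          have h2 : (st j₀).s ≤ (st (j₀ + i)).s := hmono (by omega)
          have h3 := hmax (j₀ + i + 1)
          omega
    filter_upwards [eventually_ge_atTop (j₀ + K)] with j hj
    right
    have := hk (j - j₀)
    rw [Nat.add_sub_cancel' (by omega)] at this
    omega

theorem eventually_exists_energy_le {ε : ℝ} (hε : 0 < ε) :
    ∀ᶠ j in atTop, ∃ y, P.IsKKT xs y ∧ energy P I xs (st j) y ≤ ε := by
  have hd := sub_pos.2 H.delta_mem.2
  have hd0 := H.delta_mem.1
  have htb := H.taubar_pos
  have hsb := H.sigma_pos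
  -- The factor `1 - δ` prepares for a restart, which drops the momentum terms and resets the weight
  -- to 1, and so multiplies the energy by at most `1 / (1 - δ)`.
  obtain ⟨K, hK⟩ := H.exists_energy_le_of_le_k hrun (ε := (1 - I.delta) * ε) (by positivity)
  obtain ⟨s₀, hs₀⟩ := H.exists_le_k_of_epoch_end hrun K
  have hinv := H.invariant_run hrun
  -- The shift by one is needed because the bound at the start of an epoch comes from the end of the
  -- previous one, whose index must be at least `s₀`.
  have key : ∀ j, s₀ + 1 ≤ (st j).s → ∃ y, P.IsKKT xs y ∧ energy P I xs (st j) y ≤ ε := by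
    intro j
    induction j with
    | zero =>
      intro h
      have : (st 0).s = 0 := by rw [hrun.1]; rfl
      omega
    | succ j ih =>
      intro hs
      rcases hrun.2 j with ⟨-, h⟩ | ⟨hN, h⟩
      · obtain ⟨y, hy, hle⟩ := ih (by rw [← h.s_step]; exact hs)
        exact ⟨y, hy, (H.energy_le_of_step (hinv j) h hy).trans hle⟩
      · have hs' : (st (j + 1)).s = (st j).s + 1 := by rw [h]; rfl
        obtain ⟨y, hy, hle⟩ := hK j (hs₀ j (by omega) hN)
        refine ⟨y, hy, ?_⟩
        rw [h, energy_epochStart _ _ _ _ hsb.ne']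
        have h1 := (H.le_energy (hinv j) y).trans hle
        have hw := H.weightPrev_ge (hinv j).sigmaPrev_ge
        refine le_of_mul_le_mul_left ?_ hd
        have h2 : (1 - I.delta) * (1 / (2 * taubar P I) * ‖xs - (st j).x‖ ^ 2) ≤
            weightPrev I (st j) ^ 2 / (2 * taubar P I) * ‖xs - (st j).x‖ ^ 2 := by
          rw [← mul_assoc, mul_one_div]
          gcongr
          linarith [one_le_pow₀ (n := 2) hw]
        have h3 : (1 - I.delta) * (1 / (2 * I.sigmabar) * ‖y - (st j).y‖ ^ 2) =
            (1 - I.delta) / (2 * I.sigmabar) * ‖y - (st j).y‖ ^ 2 := by ring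
        linarith
  filter_upwards [eventually_epoch_or_inner hrun (s₀ + 1) K] with j hj
  rcases hj with hj | hj
  · exact key j hj
  · obtain ⟨y, hy, hle⟩ := hK j hj
    refine ⟨y, hy, hle.trans ?_⟩
    exact mul_le_of_le_one_left hε.le (by linarith)

/-- Every limit point of the dual sequence is a multiplier. -/
theorem isKKT_of_mapClusterPt {y : Vec m}
    (hy : MapClusterPt y atTop fun j => (st j).y) : P.IsKKT xs y := by
  have hd := sub_pos.2 H.delta_mem.2
  have htb := H.taubar_pos
  have hsb := H.sigma_pos
  suffices y ∈ closure {y | P.IsKKT xs y} by rwa [(Problem.isClosed_kkt xs).closure_eq] at this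
  refine Metric.mem_closure_iff.2 fun ε hε => ?_
  have h1 := H.eventually_exists_energy_le hrun
    (ε := (1 - I.delta) / (2 * I.sigmabar) * (ε / 2) ^ 2) (by positivity)
  have h2 := mapClusterPt_iff_frequently.1 hy _ (Metric.ball_mem_nhds y (half_pos hε))
  obtain ⟨j, hj, v, hv, hle⟩ := (h2.and_eventually h1).exists
  refine ⟨v, hv, ?_⟩
  have h3 := (H.le_energy (H.invariant_run hrun j) v).trans hle
  have h4 : 0 ≤ weightPrev I (st j) ^ 2 / (2 * taubar P I) * ‖xs - (st j).x‖ ^ 2 := by positivity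
  have h5 : (1 - I.delta) / (2 * I.sigmabar) * ‖v - (st j).y‖ ^ 2 ≤
      (1 - I.delta) / (2 * I.sigmabar) * (ε / 2) ^ 2 := by linarith
  have h6 : ‖v - (st j).y‖ ≤ ε / 2 :=
    le_of_sq_le_sq (le_of_mul_le_mul_left h5 (by positivity)) (by positivity)
  have h7 := dist_triangle y (st j).y v
  rw [Metric.mem_ball, dist_comm] at hj
  rw [dist_comm (st j).y, dist_eq_norm v] at h7
  linarith

end Admissible

end RAPD

theorem theorem3 {n m : ℕ} (hm : 0 < m) (P : RAPD.Problem n m) (I : RAPD.Input n m)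
    -- the problem: convex objective, bounded below, and strongly convex constraints
    (hf_conv : ConvexOn ℝ Set.univ P.f) (hf_cont : Continuous P.f)
    (hf_bdd : BddBelow (Set.range P.f))
    (hmu : ∀ i, 0 < P.mu i) (hg_conv : ∀ i, StrongConvexOn Set.univ (P.mu i) (P.g i))
    (hg_cont : ∀ i, Continuous (P.g i))
    -- Slater's condition
    (hslater : ∀ i, P.g i P.xt < 0)
    -- no minimizer of the objective is feasible
    (hmin : ∀ x₀, (∀ x, P.f x₀ ≤ P.f x) → ∃ i, 0 < P.g i x₀)
    -- the optimal solution, and the known lower bound `r` at it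
    (xstar : RAPD.Vec n) (hopt : P.IsOptimal xstar)
    (hr_pos : 0 < P.r)
    (hr : P.r ≤ Metric.infDist 0 (RAPD.subdifferential P.f xstar))
    -- smoothness of the constraints
    (hlip : P.LipschitzAssumption)
    -- admissible input
    (hsigma : 0 < I.sigmabar) (hnu : I.nu0 ∈ Set.Ioo (0 : ℝ) 1)
    (hdelta : I.delta ∈ Set.Ioo (0 : ℝ) 1)
    (hx0 : I.x0 ∈ P.X) (hy0 : I.y0 ∈ P.Y)
    (hrho_nonneg : 0 ≤ I.rho0)
    (hrho : ∀ y, P.IsKKT xstar y → I.rho0 ≤ RAPD.norm1 y * P.muMin)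
    -- the sequence generated by the algorithm
    (st : ℕ → RAPD.State n m) (hrun : RAPD.IsRun P I st)
    -- the conditions on the step sizes
    (htau : P.rhobar < (RAPD.taubar P I)⁻¹)
    (hratio_lt : (⨅ j, (st j).sigmaPrev / (st j).sigma) < 1)
    (hratio_ge : I.delta + I.nu0 ≤ (⨅ j, (st j).sigmaPrev / (st j).sigma))
    -- any limit point of the dual sequence
    (ystar : RAPD.Vec m) (hlim : MapClusterPt ystar Filter.atTop (fun j => (st j).y)) :
    P.IsKKT xstar ystar := by
  exact RAPD.Admissible.isKKT_of_mapClusterPt (P := P) (I := I)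
    { m_pos := hm, f_conv := hf_conv, f_cont := hf_cont, f_bdd := hf_bdd, mu_pos := hmu
      g_conv := hg_conv, g_cont := hg_cont, slater := hslater, not_feasible := hmin
      opt := hopt, r_pos := hr_pos, r_le := hr, lip := hlip, sigma_pos := hsigma
      nu_mem := hnu, delta_mem := hdelta, x0_mem := hx0, y0_mem := hy0
      rho_nonneg := hrho_nonneg, rho_le := hrho } hrun hlim
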